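/- Let $R>0$, $p\in(0,1)\cup(1,+\infty)$ and $\sigma>-1$. Let $B_R\subset\mathbb{R}^2$ be the open disc of radius $R$ centred at the origin, let $\kappa=1/R$ be the curvature of its boundary, and let $u_n$ denote the outward normal derivative of $u$. Consider the Steklov problem $$(1)\qquad \begin{cases}\Delta^2 u=|u|^{p-1}u & \text{in } B_R,\\ u=\Delta u-(1-\sigma)\kappa u_n=0 & \text{on }\partial B_R,\end{cases}$$ where a solution is a classical one, that is, a function $u\in C^4(B_R)\cap C^2(\overline{B_R})$ satisfying (1) pointwise; it is called positive if $u>0$ in $B_R$ and radial if $u(x)$ depends only on $|x|$ for $x\in\overline{B_R}$. Then (1) has exactly one positive radial solution $u$. Moreover $u\in C^4(\overline{B_R})$, and $u$ is strictly decreasing in the radial variable: $u(y)<u(x)$ whenever $x,y\in\overline{B_R}$ and $|x|<|y|$. -/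

import Mathlib

open InnerProductSpace Metric Set
open scoped ContDiff

/-- The Euclidean plane `ℝ²`. -/
abbrev Plane : Type := EuclideanSpace ℝ (Fin 2)

/-- The outward normal derivative `u_n` of `u` at a boundary point `x` of the closed ball of
radius `R` centred at the origin: the derivative of `u`, taken within the closed ball (that is,
the continuous extension of the interior derivative), in the direction of the outward unit
normal `x / R`. -/
noncomputable def outwardNormalDeriv (R : ℝ) (u : Plane → ℝ) (x : Plane) : ℝ :=
  fderivWithin ℝ u (closedBall 0 R) x (R⁻¹ • x)

/-- `u` is a classical solution of the Steklov problem
`Δ² u = |u|^(p-1) u` in `B_R`, `u = Δ u - (1 - σ) κ u_n = 0` on `∂B_R`, where `κ = 1 / R`.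
The function is `C⁴` in the open disc and `C²` up to the boundary; on the boundary `Δ u` is
computed from the second derivative within the closed disc, i.e. from the continuous extension
of the interior second derivative. Only the values of `u` on the closed disc matter. -/
structure IsSteklovSolution (p σ R : ℝ) (u : Plane → ℝ) : Prop where
  contDiffOn_ball : ContDiffOn ℝ 4 u (ball 0 R)
  contDiffOn_closedBall : ContDiffOn ℝ 2 u (closedBall 0 R)
  equation : ∀ x ∈ ball (0 : Plane) R,
    Laplacian.laplacian (Laplacian.laplacian u) x = |u x| ^ (p - 1) * u x
  boundary_zero : ∀ x ∈ sphere (0 : Plane) R, u x = 0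
  boundary_steklov : ∀ x ∈ sphere (0 : Plane) R,
    laplacianWithin u (closedBall 0 R) x - (1 - σ) * (1 / R) * outwardNormalDeriv R u x = 0

/-- `u` is radial on the closed disc of radius `R`: its value depends only on `‖x‖`. -/
def IsRadialOn (R : ℝ) (u : Plane → ℝ) : Prop :=
  ∀ x ∈ closedBall (0 : Plane) R, ∀ y ∈ closedBall (0 : Plane) R, ‖x‖ = ‖y‖ → u x = u y

/-- `u` is a classical solution of the Steklov problem that is radial, and positive in the
open disc. -/
structure IsPositiveRadialSteklovSolution (p σ R : ℝ) (u : Plane → ℝ) : Prop where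
  solution : IsSteklovSolution p σ R u
  radial : IsRadialOn R u
  pos : ∀ x ∈ ball (0 : Plane) R, 0 < u x

/-- `u` is strictly decreasing in the radial variable on the closed disc of radius `R`. -/
def IsStrictlyRadiallyDecreasing (R : ℝ) (u : Plane → ℝ) : Prop :=
  ∀ x ∈ closedBall (0 : Plane) R, ∀ y ∈ closedBall (0 : Plane) R, ‖x‖ < ‖y‖ → u y < u x

/-! In the variable `t = |x|²/4` the planar Laplacian of a radial function is `(t V')'`, so the
problem becomes the system `(t V')' = W`, `(t W')' = f V` on `[0, R²/4]`. Regularity at the origin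
turns it into `V' = mean W`, `W' = mean (f ∘ V)`. Both boundary conditions sit at `T = R²/4`: `V T =
0` and `trace c W T = 0` with `c = (1 - σ)/2`, so `σ > -1` means exactly `c < 1`.

The nonlinearity is nonnegative and nondecreasing, which makes the system cooperative: raising `W 0`
at fixed `V 0` raises `V`, `W` and the trace (`IsProfile.comparison`, `IsProfile.trace_lt_trace`).
Along one profile the trace is nondecreasing (`IsProfile.monotoneOn_trace`).

Uniqueness: two solutions with equal `V 0`, possibly on different intervals, cannot have different
`W 0` (`IsSolution.not_snd_lt`), hence coincide by uniqueness of the initial value problem while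
positive. Since `p ≠ 1`, scaling makes the values at the origin equal at the price of moving the
endpoint; equality of endpoints then forces the scaling to be trivial (`IsSolution.eqOn`).

Existence: shoot with `V 0 = 1` and `W 0 = β`, for a truncated nonlinearity, and take the supremum
of the `β` for which `V` and the trace are both nonpositive at some point. The limits of the
profiles as `β` tends to this value from below and from above agree up to the first zero, where the
trace must vanish (`exists_isSolution_of_bounded`). Both limits are needed because for `p < 1` the
nonlinearity is not Lipschitz at `0` and uniqueness may fail beyond the first zero. Scaling then
sets the endpoint.

Strict decrease is the inequality `mean W < 0` (`IsSolution.mean_snd_neg`); regularity up to the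
boundary comes from bootstrapping (`IsSolution.contDiffOn`). -/

namespace Steklov

open MeasureTheory Filter Topology

/-! ### Averages and the radial potential -/

/-- The average of `g` over the segment from `0` to `t`. -/
noncomputable def mean (g : ℝ → ℝ) (t : ℝ) : ℝ := ∫ s in (0 : ℝ)..1, g (t * s)

/-- The solution `V` of `(t V')' = g` with `V 0 = 0` that is regular at the origin. -/
noncomputable def pot (g : ℝ → ℝ) (t : ℝ) : ℝ := ∫ s in (0 : ℝ)..t, mean g s

variable {g h : ℝ → ℝ} {t : ℝ}

theorem continuous_mean (hg : Continuous g) : Continuous (mean g) :=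
  intervalIntegral.continuous_parametric_intervalIntegral_of_continuous'
    (f := fun t s => g (t * s)) (by fun_prop) 0 1

theorem continuous_pot (hg : Continuous g) : Continuous (pot g) :=
  intervalIntegral.continuous_primitive
    (fun _ _ => (continuous_mean hg).intervalIntegrable _ _) 0

theorem pot_zero (g : ℝ → ℝ) : pot g 0 = 0 := by simp [pot]

theorem mul_mean (g : ℝ → ℝ) (t : ℝ) : t * mean g t = ∫ s in (0 : ℝ)..t, g s := by
  simp [mean, intervalIntegral.mul_integral_comp_mul_left]

theorem mean_mono (hg : Continuous g) (hh : Continuous h) (ht : 0 ≤ t)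
    (H : ∀ s ∈ Icc 0 t, g s ≤ h s) : mean g t ≤ mean h t := by
  refine intervalIntegral.integral_mono_on zero_le_one
    (Continuous.intervalIntegrable (by fun_prop) _ _)
    (Continuous.intervalIntegrable (by fun_prop) _ _) fun s hs => H _ ?_
  exact ⟨mul_nonneg ht hs.1, mul_le_of_le_one_right ht hs.2⟩

theorem mean_congr (ht : 0 ≤ t) (H : ∀ s ∈ Icc 0 t, g s = h s) : mean g t = mean h t := by
  refine intervalIntegral.integral_congr fun s hs => H _ ?_
  rw [uIcc_of_le zero_le_one] at hs
  exact ⟨mul_nonneg ht hs.1, mul_le_of_le_one_right ht hs.2⟩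

theorem mean_const (a t : ℝ) : mean (fun _ => a) t = a := by simp [mean]

theorem mean_sub (hg : Continuous g) (hh : Continuous h) (t : ℝ) :
    mean (fun s => g s - h s) t = mean g t - mean h t := by
  refine intervalIntegral.integral_sub ?_ ?_ <;>
    exact Continuous.intervalIntegrable (by fun_prop) _ _

theorem mean_add_const (hg : Continuous g) (a t : ℝ) :
    mean (fun s => a + g s) t = a + mean g t := by
  unfold mean
  rw [intervalIntegral.integral_add (by simp) (Continuous.intervalIntegrable (by fun_prop) _ _)]
  simp

theorem mean_le_const (hg : Continuous g) (ht : 0 ≤ t) {a : ℝ} (H : ∀ s ∈ Icc 0 t, g s ≤ a) :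
    mean g t ≤ a := by
  simpa [mean_const] using mean_mono hg continuous_const ht H

theorem const_le_mean (hg : Continuous g) (ht : 0 ≤ t) {a : ℝ} (H : ∀ s ∈ Icc 0 t, a ≤ g s) :
    a ≤ mean g t := by
  simpa [mean_const] using mean_mono continuous_const hg ht H

theorem pot_mono (hg : Continuous g) (hh : Continuous h) (ht : 0 ≤ t)
    (H : ∀ s ∈ Icc 0 t, g s ≤ h s) : pot g t ≤ pot h t :=
  intervalIntegral.integral_mono_on ht ((continuous_mean hg).intervalIntegrable _ _)
    ((continuous_mean hh).intervalIntegrable _ _) fun _ hs =>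
      mean_mono hg hh hs.1 fun r hr => H r ⟨hr.1, hr.2.trans hs.2⟩

theorem pot_congr (ht : 0 ≤ t) (H : ∀ s ∈ Icc 0 t, g s = h s) : pot g t = pot h t := by
  refine intervalIntegral.integral_congr fun s hs => ?_
  rw [uIcc_of_le ht] at hs
  exact mean_congr hs.1 fun r hr => H r ⟨hr.1, hr.2.trans hs.2⟩

theorem pot_sub (hg : Continuous g) (hh : Continuous h) (t : ℝ) :
    pot (fun s => g s - h s) t = pot g t - pot h t := by
  unfold pot
  rw [← intervalIntegral.integral_sub ((continuous_mean hg).intervalIntegrable _ _)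
    ((continuous_mean hh).intervalIntegrable _ _)]
  exact intervalIntegral.integral_congr fun s _ => mean_sub hg hh s

theorem pot_const (a t : ℝ) : pot (fun _ => a) t = t * a := by
  simp [pot, mean_const]

theorem pot_add_const (hg : Continuous g) (a t : ℝ) :
    pot (fun s => a + g s) t = t * a + pot g t := by
  unfold pot
  simp_rw [mean_add_const hg]
  rw [intervalIntegral.integral_add (by simp) ((continuous_mean hg).intervalIntegrable _ _)]
  simp

theorem pot_nonneg (hg : Continuous g) (ht : 0 ≤ t) (H : ∀ s ∈ Icc 0 t, 0 ≤ g s) :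
    0 ≤ pot g t := by
  simpa [pot_const] using pot_mono continuous_const hg ht H

theorem hasDerivAt_pot (hg : Continuous g) (t : ℝ) : HasDerivAt (pot g) (mean g t) t :=
  intervalIntegral.integral_hasDerivAt_right ((continuous_mean hg).intervalIntegrable _ _)
    ((continuous_mean hg).stronglyMeasurableAtFilter _ _) (continuous_mean hg).continuousAt

theorem hasDerivAt_mul_mean (hg : Continuous g) (t : ℝ) :
    HasDerivAt (fun t => t * mean g t) (g t) t := by
  simp_rw [mul_mean]
  exact intervalIntegral.integral_hasDerivAt_right (hg.intervalIntegrable _ _)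
    (hg.stronglyMeasurableAtFilter _ _) hg.continuousAt

theorem mean_comp_mul (g : ℝ → ℝ) (a t : ℝ) : mean (fun s => g (a * s)) t = mean g (a * t) := by
  simp [mean, mul_assoc]

theorem pot_comp_mul (g : ℝ → ℝ) (a t : ℝ) :
    a * pot (fun s => g (a * s)) t = pot g (a * t) := by
  unfold pot
  simp_rw [mean_comp_mul]
  simp [intervalIntegral.mul_integral_comp_mul_left]

theorem mean_const_mul (g : ℝ → ℝ) (a t : ℝ) : mean (fun s => a * g s) t = a * mean g t := by
  simp [mean]

theorem pot_const_mul (g : ℝ → ℝ) (a t : ℝ) : pot (fun s => a * g s) t = a * pot g t := by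
  simp [pot, mean_const_mul]

/-- Dominated convergence for averages. -/
theorem tendsto_mean {G : ℕ → ℝ → ℝ} (hG : ∀ n, Continuous (G n)) (ht : 0 ≤ t) {B : ℝ}
    (hB : ∀ n, ∀ s ∈ Icc 0 t, |G n s| ≤ B)
    (hlim : ∀ s ∈ Icc 0 t, Tendsto (fun n => G n s) atTop (𝓝 (g s))) :
    Tendsto (fun n => mean (G n) t) atTop (𝓝 (mean g t)) := by
  have key : ∀ s ∈ uIoc (0 : ℝ) 1, t * s ∈ Icc 0 t := fun s hs => by
    rw [uIoc_of_le zero_le_one] at hs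
    exact ⟨mul_nonneg ht hs.1.le, mul_le_of_le_one_right ht hs.2⟩
  refine intervalIntegral.tendsto_integral_filter_of_dominated_convergence (fun _ => B) ?_ ?_
    (by simp) ?_
  · exact .of_forall fun n => ((hG n).comp (by fun_prop)).aestronglyMeasurable
  · exact .of_forall fun n => .of_forall fun s hs => hB n _ (key s hs)
  · exact .of_forall fun s hs => hlim _ (key s hs)

theorem abs_mean_le (hg : Continuous g) (ht : 0 ≤ t) {B : ℝ} (hB : ∀ s ∈ Icc 0 t, |g s| ≤ B) :
    |mean g t| ≤ B :=
  abs_le.2 ⟨const_le_mean hg ht fun s hs => (abs_le.1 (hB s hs)).1,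
    mean_le_const hg ht fun s hs => (abs_le.1 (hB s hs)).2⟩

/-- Dominated convergence for the potential. -/
theorem tendsto_pot {G : ℕ → ℝ → ℝ} (hG : ∀ n, Continuous (G n)) (ht : 0 ≤ t) {B : ℝ}
    (hB : ∀ n, ∀ s ∈ Icc 0 t, |G n s| ≤ B)
    (hlim : ∀ s ∈ Icc 0 t, Tendsto (fun n => G n s) atTop (𝓝 (g s))) :
    Tendsto (fun n => pot (G n) t) atTop (𝓝 (pot g t)) := by
  have key : ∀ s ∈ uIoc (0 : ℝ) t, s ∈ Icc 0 t := fun s hs => by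
    rw [uIoc_of_le ht] at hs
    exact ⟨hs.1.le, hs.2⟩
  refine intervalIntegral.tendsto_integral_filter_of_dominated_convergence (fun _ => B) ?_ ?_
    (by simp) ?_
  · exact .of_forall fun n => (continuous_mean (hG n)).aestronglyMeasurable
  · exact .of_forall fun n => .of_forall fun s hs => abs_mean_le (hG n) (key s hs).1
      fun r hr => hB n r ⟨hr.1, hr.2.trans (key s hs).2⟩
  · exact .of_forall fun s hs => tendsto_mean hG (key s hs).1
      (fun n r hr => hB n r ⟨hr.1, hr.2.trans (key s hs).2⟩)
      fun r hr => hlim r ⟨hr.1, hr.2.trans (key s hs).2⟩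

end Steklov

namespace Steklov

open MeasureTheory Filter Topology

/-! ### Radial profiles -/

/-- `V` and `W` solve `(t V')' = W`, `(t W')' = f V` on `[0, T]`, regularly at the origin. -/
structure IsProfile (f : ℝ → ℝ) (T : ℝ) (V W : ℝ → ℝ) : Prop where
  cont_fst : Continuous V
  cont_snd : Continuous W
  fst_eq : ∀ t ∈ Icc 0 T, V t = V 0 + pot W t
  snd_eq : ∀ t ∈ Icc 0 T, W t = W 0 + pot (fun s => f (V s)) t

/-- The boundary expression `W - c V'` along a profile, where `V' = mean W`. -/
noncomputable def trace (c : ℝ) (W : ℝ → ℝ) (t : ℝ) : ℝ := W t - c * mean W t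

theorem continuous_trace (c : ℝ) {W : ℝ → ℝ} (hW : Continuous W) : Continuous (trace c W) :=
  hW.sub (continuous_const.mul (continuous_mean hW))

/-- Multiplied by `t`, this compares the integrals of `q ≥ 0` over `[0, s t]` and `[0, t]`. -/
theorem mul_mean_mul_le {q : ℝ → ℝ} (hq : Continuous q) {s t : ℝ} (hs : s ∈ Icc 0 1)
    (ht : 0 < t) (H : ∀ r ∈ Icc 0 t, 0 ≤ q r) : s * mean q (s * t) ≤ mean q t := by
  refine le_of_mul_le_mul_left ?_ ht
  calc t * (s * mean q (s * t)) = (s * t) * mean q (s * t) := by ring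
    _ ≤ t * mean q t := by
      rw [mul_mean, mul_mean]
      have h1 : 0 ≤ s * t := mul_nonneg hs.1 ht.le
      have h2 : s * t ≤ t := mul_le_of_le_one_left ht.le hs.2
      rw [← intervalIntegral.integral_add_adjacent_intervals (b := s * t)
        (hq.intervalIntegrable 0 _) (hq.intervalIntegrable _ t)]
      have := intervalIntegral.integral_nonneg (μ := volume) h2
        fun r hr => H r ⟨h1.trans hr.1, hr.2⟩
      linarith

theorem monotoneOn_pot_sub_pot_mul {q : ℝ → ℝ} (hq : Continuous q) {s T : ℝ} (hs : s ∈ Icc 0 1)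
    (H : ∀ r ∈ Icc 0 T, 0 ≤ q r) : MonotoneOn (fun t => pot q t - pot q (s * t)) (Icc 0 T) := by
  have hd : ∀ t, HasDerivAt (fun t => pot q t - pot q (s * t)) (mean q t - mean q (s * t) * s) t :=
    fun t => (hasDerivAt_pot hq t).sub
      (((hasDerivAt_pot hq (s * t)).comp t ((hasDerivAt_id t).const_mul s)).congr_deriv (by simp))
  refine monotoneOn_of_deriv_nonneg (convex_Icc 0 T)
    (fun t _ => (hd t).continuousAt.continuousWithinAt)
    (fun t _ => (hd t).differentiableAt.differentiableWithinAt) fun t ht => ?_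
  rw [interior_Icc] at ht
  rw [(hd t).deriv]
  have := mul_mean_mul_le hq hs ht.1 fun r hr => H r ⟨hr.1, hr.2.trans ht.2.le⟩
  linarith

theorem monotoneOn_pot {q : ℝ → ℝ} (hq : Continuous q) {T : ℝ} (H : ∀ r ∈ Icc 0 T, 0 ≤ q r) :
    MonotoneOn (pot q) (Icc 0 T) := by
  simpa [pot_zero] using monotoneOn_pot_sub_pot_mul hq (s := 0) (by simp) H

theorem monotoneOn_mean {W : ℝ → ℝ} (hW : Continuous W) {T : ℝ} (H : MonotoneOn W (Icc 0 T)) :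
    MonotoneOn (mean W) (Icc 0 T) := by
  intro a ha b hb hab
  refine intervalIntegral.integral_mono_on zero_le_one
    (Continuous.intervalIntegrable (by fun_prop) _ _)
    (Continuous.intervalIntegrable (by fun_prop) _ _) fun s hs => ?_
  exact H ⟨mul_nonneg ha.1 hs.1, (mul_le_of_le_one_right ha.1 hs.2).trans ha.2⟩
    ⟨mul_nonneg hb.1 hs.1, (mul_le_of_le_one_right hb.1 hs.2).trans hb.2⟩
    (mul_le_mul_of_nonneg_right hab hs.1)

theorem mean_le_of_monotoneOn {W : ℝ → ℝ} (hW : Continuous W) {T t : ℝ}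
    (H : MonotoneOn W (Icc 0 T)) (ht : t ∈ Icc 0 T) : mean W t ≤ W t :=
  mean_le_const hW ht.1 fun _ hs => H ⟨hs.1, hs.2.trans ht.2⟩ ht hs.2

theorem le_mean_of_monotoneOn {W : ℝ → ℝ} (hW : Continuous W) {T t : ℝ}
    (H : MonotoneOn W (Icc 0 T)) (ht : t ∈ Icc 0 T) : W 0 ≤ mean W t :=
  const_le_mean hW ht.1 fun _ hs => H ⟨le_rfl, ht.1.trans ht.2⟩ ⟨hs.1, hs.2.trans ht.2⟩ hs.1

/-- `W t - mean W t` is the average over `s ∈ [0, 1]` of `W t - W (t s)`, and each of these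
differences is nondecreasing in `t` by `monotoneOn_pot_sub_pot_mul`. -/
theorem monotoneOn_sub_mean {q W : ℝ → ℝ} (hq : Continuous q) (hW : Continuous W) {T : ℝ}
    (H : ∀ r ∈ Icc 0 T, 0 ≤ q r) (hWq : ∀ t ∈ Icc 0 T, W t = W 0 + pot q t) :
    MonotoneOn (fun t => W t - mean W t) (Icc 0 T) := by
  have key : ∀ t, W t - mean W t = ∫ s in (0 : ℝ)..1, (W t - W (t * s)) := fun t => by
    rw [intervalIntegral.integral_sub (by simp) (Continuous.intervalIntegrable (by fun_prop) _ _)]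
    simp [mean]
  intro a ha b hb hab
  simp only [key]
  refine intervalIntegral.integral_mono_on zero_le_one
    (Continuous.intervalIntegrable (by fun_prop) _ _)
    (Continuous.intervalIntegrable (by fun_prop) _ _) fun s hs => ?_
  have h1 := monotoneOn_pot_sub_pot_mul hq hs H ha hb hab
  have h2 : ∀ t ∈ Icc 0 T, t * s ∈ Icc 0 T := fun t ht =>
    ⟨mul_nonneg ht.1 hs.1, (mul_le_of_le_one_right ht.1 hs.2).trans ht.2⟩
  rw [hWq a ha, hWq b hb, hWq _ (h2 a ha), hWq _ (h2 b hb)]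
  simp only [mul_comm s] at h1
  linarith

/-- The trace is `(D - mean D) + (1 - c) * mean D`; for nondecreasing `D` the first term is
nonnegative, and `mean D ≥ D 0 > 0`. -/
theorem trace_pos {c : ℝ} (hc : c < 1) {D : ℝ → ℝ} (hD : Continuous D) {T t : ℝ}
    (H : MonotoneOn D (Icc 0 T)) (h0 : 0 < D 0) (ht : t ∈ Icc 0 T) : 0 < trace c D t := by
  have h1 := mean_le_of_monotoneOn hD H ht
  have h2 := le_mean_of_monotoneOn hD H ht
  unfold trace
  rcases le_total c 0 with h | h <;> nlinarith

/-! ### Monotonicity and comparison of profiles -/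

namespace IsProfile

variable {f : ℝ → ℝ} {T c : ℝ} {V W V₁ W₁ V₂ W₂ : ℝ → ℝ}

theorem mono (h : IsProfile f T V W) {T' : ℝ} (hT : T' ≤ T) : IsProfile f T' V W :=
  ⟨h.1, h.2, fun t ht => h.3 t ⟨ht.1, ht.2.trans hT⟩, fun t ht => h.4 t ⟨ht.1, ht.2.trans hT⟩⟩

theorem congr {f' : ℝ → ℝ} (h : IsProfile f T V W) (hf : ∀ t ∈ Icc 0 T, f (V t) = f' (V t)) :
    IsProfile f' T V W :=
  ⟨h.1, h.2, h.3, fun t ht => (h.4 t ht).trans <| congrArg _ <|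
    pot_congr ht.1 fun s hs => hf s ⟨hs.1, hs.2.trans ht.2⟩⟩

theorem continuous_comp (h : IsProfile f T V W) (hf : Continuous f) :
    Continuous fun s => f (V s) := hf.comp h.1

theorem monotoneOn_snd (h : IsProfile f T V W) (hf : Continuous f) (hf0 : ∀ x, 0 ≤ f x) :
    MonotoneOn W (Icc 0 T) := fun a ha b hb hab => by
  rw [h.snd_eq a ha, h.snd_eq b hb]
  exact add_le_add le_rfl (monotoneOn_pot (hf.comp h.1) (fun _ _ => hf0 _) ha hb hab)

/-- Write the trace as `(W - mean W) + (1 - c) * mean W`: both terms are nondecreasing, the first by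
`monotoneOn_sub_mean`. -/
theorem monotoneOn_trace (h : IsProfile f T V W) (hf : Continuous f) (hf0 : ∀ x, 0 ≤ f x)
    (hc : c < 1) : MonotoneOn (trace c W) (Icc 0 T) := by
  intro a ha b hb hab
  have h1 := h.monotoneOn_snd hf hf0 ha hb hab
  have h2 := monotoneOn_mean h.2 (h.monotoneOn_snd hf hf0) ha hb hab
  have h3 := monotoneOn_sub_mean (hf.comp h.1) h.2 (fun _ _ => hf0 _) h.4 ha hb hab
  unfold trace
  simp only at h3
  rcases le_total c 0 with h | h <;> nlinarith

/-- A profile whose trace is nonpositive at `T` is nonincreasing there. -/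
theorem mean_snd_nonpos (h : IsProfile f T V W) (hf : Continuous f) (hf0 : ∀ x, 0 ≤ f x)
    (hc : c < 1) {t : ℝ} (ht : t ∈ Icc 0 T) (hΦ : trace c W t ≤ 0) : mean W t ≤ 0 := by
  have := mean_le_of_monotoneOn h.2 (h.monotoneOn_snd hf hf0) ht
  unfold trace at hΦ
  nlinarith

theorem hasDerivWithinAt_fst (h : IsProfile f T V W) {t : ℝ} (ht : t ∈ Icc 0 T) :
    HasDerivWithinAt V (mean W t) (Icc 0 T) t :=
  ((hasDerivAt_pot h.2 t).const_add (V 0)).hasDerivWithinAt.congr h.3 (h.3 t ht)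

theorem hasDerivWithinAt_snd (h : IsProfile f T V W) (hf : Continuous f) {t : ℝ}
    (ht : t ∈ Icc 0 T) :
    HasDerivWithinAt W (mean (fun s => f (V s)) t) (Icc 0 T) t :=
  ((hasDerivAt_pot (hf.comp h.1) t).const_add (W 0)).hasDerivWithinAt.congr h.4 (h.4 t ht)

/-- The cooperative comparison principle. -/
theorem comparison (h₁ : IsProfile f T V₁ W₁) (h₂ : IsProfile f T V₂ W₂) (hf : Continuous f)
    (hm : Monotone f) (hV : V₁ 0 ≤ V₂ 0) (hW : W₁ 0 < W₂ 0) :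
    (∀ t ∈ Icc 0 T, V₁ t ≤ V₂ t) ∧ MonotoneOn (fun t => W₂ t - W₁ t) (Icc 0 T) := by
  have fst_le : ∀ τ ∈ Icc 0 T, (∀ s ∈ Icc 0 τ, W₁ s ≤ W₂ s) → V₁ τ ≤ V₂ τ := fun τ hτ H => by
    rw [h₁.3 τ hτ, h₂.3 τ hτ]
    exact add_le_add hV (pot_mono h₁.2 h₂.2 hτ.1 H)
  have snd_lt : ∀ τ ∈ Icc 0 T, (∀ s ∈ Icc 0 τ, V₁ s ≤ V₂ s) → W₁ τ < W₂ τ := fun τ hτ H => by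
    rw [h₁.4 τ hτ, h₂.4 τ hτ]
    exact add_lt_add_of_lt_of_le hW
      (pot_mono (hf.comp h₁.1) (hf.comp h₂.1) hτ.1 fun s hs => hm (H s hs))
  -- At the first point `τ` where the order of `W₁` and `W₂` fails, `V₁ ≤ V₂` still holds on `[0,
  -- τ]`; integrating the second equation keeps the initial gap, so `W₁ τ < W₂ τ` after all.
  have pos : ∀ t ∈ Icc 0 T, W₁ t < W₂ t := by
    by_contra! hcon
    set S := Icc 0 T ∩ {t | W₂ t ≤ W₁ t}
    have hS : IsCompact S := isCompact_Icc.inter_right (isClosed_le h₂.2 h₁.2)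
    obtain ⟨t, ht⟩ := hcon
    obtain ⟨τ, hτ⟩ := hS.exists_isLeast ⟨t, ht⟩
    have hlt : ∀ s ∈ Ico 0 τ, W₁ s < W₂ s := fun s hs => by
      by_contra! hle
      exact absurd (hτ.2 ⟨⟨hs.1, hs.2.le.trans hτ.1.1.2⟩, hle⟩) (not_le.2 hs.2)
    have hVlt : ∀ s ∈ Ico 0 τ, V₁ s ≤ V₂ s := fun s hs =>
      fst_le s ⟨hs.1, hs.2.le.trans hτ.1.1.2⟩ fun r hr => (hlt r ⟨hr.1, hr.2.trans_lt hs.2⟩).le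
    rcases hτ.1.1.1.eq_or_lt with h0 | h0
    · exact absurd (h0 ▸ hτ.1.2 : W₂ 0 ≤ W₁ 0) (not_le.2 hW)
    have hVle : ∀ s ∈ Icc 0 τ, V₁ s ≤ V₂ s := by
      intro s hs
      have : closure (Ico 0 τ) ⊆ {s | V₁ s ≤ V₂ s} :=
        closure_minimal hVlt (isClosed_le h₁.1 h₂.1)
      rw [closure_Ico h0.ne] at this
      exact this hs
    exact absurd hτ.1.2 (not_le.2 (snd_lt τ hτ.1.1 hVle))
  have hVall : ∀ t ∈ Icc 0 T, V₁ t ≤ V₂ t := fun t ht =>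
    fst_le t ht fun s hs => (pos s ⟨hs.1, hs.2.trans ht.2⟩).le
  refine ⟨hVall, fun a ha b hb hab => ?_⟩
  have e := pot_sub (h₂.continuous_comp hf) (h₁.continuous_comp hf)
  have := monotoneOn_pot (q := fun s => f (V₂ s) - f (V₁ s)) (T := T)
    ((h₂.continuous_comp hf).sub (h₁.continuous_comp hf))
    (fun r hr => sub_nonneg.2 (hm (hVall r hr))) ha hb hab
  simp only [e] at this
  simp only [h₁.4 a ha, h₁.4 b hb, h₂.4 a ha, h₂.4 b hb]
  linarith

theorem trace_lt_trace (h₁ : IsProfile f T V₁ W₁) (h₂ : IsProfile f T V₂ W₂) (hf : Continuous f)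
    (hm : Monotone f) (hV : V₁ 0 ≤ V₂ 0) (hW : W₁ 0 < W₂ 0) (hc : c < 1) {t : ℝ}
    (ht : t ∈ Icc 0 T) : trace c W₁ t < trace c W₂ t := by
  have := trace_pos (D := fun s => W₂ s - W₁ s) hc (h₂.2.sub h₁.2)
    (h₁.comparison h₂ hf hm hV hW).2 (sub_pos.2 hW) ht
  simp only [trace, mean_sub h₂.2 h₁.2] at this ⊢
  linarith

end IsProfile

/-- The gain `1 / k` makes the integral equations a contraction in the norm weighted by `exp (-k
t)`, which replaces Gronwall's inequality in the uniqueness proof. -/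
theorem abs_pot_le_exp {g : ℝ → ℝ} (hg : Continuous g) {t k M : ℝ} (ht : 0 ≤ t) (hk : 0 < k)
    (hM : 0 ≤ M) (H : ∀ s ∈ Icc 0 t, |g s| ≤ M * Real.exp (k * s)) :
    |pot g t| ≤ M * Real.exp (k * t) / k := by
  have h1 : |pot g t| ≤ ∫ s in (0 : ℝ)..t, M * Real.exp (k * s) := by
    refine intervalIntegral.norm_integral_le_of_norm_le (μ := volume) (f := mean g)
      (g := fun s => M * Real.exp (k * s)) ht
      (.of_forall fun s hs => ?_)
      ((by fun_prop : Continuous fun s => M * Real.exp (k * s)).intervalIntegrable _ _)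
    refine abs_mean_le hg hs.1.le fun r hr => (H r ⟨hr.1, hr.2.trans hs.2⟩).trans ?_
    gcongr
    exact hr.2
  refine h1.trans ?_
  rw [intervalIntegral.integral_const_mul,
    intervalIntegral.integral_comp_mul_left (fun x => Real.exp x) hk.ne', integral_exp]
  simp only [mul_zero, Real.exp_zero, smul_eq_mul]
  rw [mul_div_assoc, div_eq_inv_mul]
  gcongr
  linarith

/-! ### Uniqueness for the initial value problem, and scaling -/

namespace IsProfile

variable {f : ℝ → ℝ} {T c : ℝ} {V W V₁ W₁ V₂ W₂ : ℝ → ℝ}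

/-- Uniqueness for the initial value problem, in a range where `f` is Lipschitz. -/
theorem eqOn_of_lipschitz (h₁ : IsProfile f T V₁ W₁) (h₂ : IsProfile f T V₂ W₂)
    (hf : Continuous f) {I : Set ℝ} {C : ℝ} (hC : 0 ≤ C)
    (hL : ∀ x ∈ I, ∀ y ∈ I, |f x - f y| ≤ C * |x - y|)
    (hI₁ : ∀ t ∈ Icc 0 T, V₁ t ∈ I) (hI₂ : ∀ t ∈ Icc 0 T, V₂ t ∈ I)
    (hV : V₁ 0 = V₂ 0) (hW : W₁ 0 = W₂ 0) : EqOn V₁ V₂ (Icc 0 T) := by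
  intro t ht
  -- With this `k` the two equations give `d τ ≤ (1 + C) / k * d τ = d τ / 2` at a maximum point `τ`
  -- of the weighted distance, so `d` vanishes.
  set k := 2 * (1 + C)
  have hk : 0 < k := by positivity
  set d := fun t => |V₁ t - V₂ t| + |W₁ t - W₂ t|
  have hd : Continuous d := (h₁.1.sub h₂.1).abs.add (h₁.2.sub h₂.2).abs
  obtain ⟨τ, hτ, hmax⟩ := isCompact_Icc.exists_isMaxOn ⟨t, ht⟩
    (f := fun t => d t * Real.exp (-(k * t))) (Continuous.continuousOn (by fun_prop))
  set M := d τ * Real.exp (-(k * τ))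
  have hM : 0 ≤ M := by positivity
  have hdM : ∀ s ∈ Icc 0 T, d s ≤ M * Real.exp (k * s) := fun s hs => by
    have h : d s * Real.exp (-(k * s)) ≤ M := hmax hs
    rwa [Real.exp_neg, ← div_eq_mul_inv, div_le_iff₀ (Real.exp_pos _)] at h
  have e1 : |V₁ τ - V₂ τ| ≤ M * Real.exp (k * τ) / k := by
    rw [h₁.3 τ hτ, h₂.3 τ hτ, hV, add_sub_add_left_eq_sub, ← pot_sub h₁.2 h₂.2]
    refine abs_pot_le_exp (h₁.2.sub h₂.2) hτ.1 hk hM fun s hs => ?_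
    exact (le_add_of_nonneg_left (abs_nonneg _)).trans (hdM s ⟨hs.1, hs.2.trans hτ.2⟩)
  have e2 : |W₁ τ - W₂ τ| ≤ (C * M) * Real.exp (k * τ) / k := by
    rw [h₁.4 τ hτ, h₂.4 τ hτ, hW, add_sub_add_left_eq_sub,
      ← pot_sub (h₁.continuous_comp hf) (h₂.continuous_comp hf)]
    refine abs_pot_le_exp ((hf.comp h₁.1).sub (hf.comp h₂.1)) hτ.1 hk (by positivity)
      fun s hs => ?_
    have hs' : s ∈ Icc 0 T := ⟨hs.1, hs.2.trans hτ.2⟩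
    refine (hL _ (hI₁ s hs') _ (hI₂ s hs')).trans ?_
    rw [mul_assoc]
    gcongr
    exact (le_add_of_nonneg_right (abs_nonneg _)).trans (hdM s hs')
  have e3 : d τ = M * Real.exp (k * τ) := by
    simp only [M, mul_assoc, ← Real.exp_add]
    simp
  have e4 : d τ ≤ (1 + C) * (M * Real.exp (k * τ)) / k := by
    calc d τ ≤ _ := add_le_add e1 e2
      _ = _ := by ring
  rw [← e3, div_eq_mul_inv, mul_right_comm] at e4
  have e5 : (1 + C) * k⁻¹ = 1 / 2 := by
    simp only [k]
    field_simp
  rw [e5] at e4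
  have hdτ : d τ = 0 := le_antisymm (by linarith) (by positivity)
  have hM0 : M = 0 := by simp [M, hdτ]
  have : d t ≤ 0 := by simpa [hM0] using hdM t ht
  have h3 : |V₁ t - V₂ t| ≤ 0 := (le_add_of_nonneg_right (abs_nonneg _)).trans this
  exact sub_eq_zero.1 (abs_nonpos_iff.1 h3)

/-- Uniqueness for the initial value problem, as long as the solutions stay positive. -/
theorem eqOn_of_pos (h₁ : IsProfile f T V₁ W₁) (h₂ : IsProfile f T V₂ W₂) (hf : Continuous f)
    (hL : ∀ ε M : ℝ, 0 < ε → ∃ C, 0 ≤ C ∧ ∀ x ∈ Icc ε M, ∀ y ∈ Icc ε M,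
      |f x - f y| ≤ C * |x - y|)
    (hp₁ : ∀ t ∈ Ico 0 T, 0 < V₁ t) (hp₂ : ∀ t ∈ Ico 0 T, 0 < V₂ t)
    (hV : V₁ 0 = V₂ 0) (hW : W₁ 0 = W₂ 0) (hT : 0 < T) : EqOn V₁ V₂ (Icc 0 T) := by
  have key : EqOn V₁ V₂ (Ico 0 T) := by
    intro t ht
    have hne : (Icc 0 t).Nonempty := ⟨0, le_rfl, ht.1⟩
    obtain ⟨a, ha, hamin⟩ := isCompact_Icc.exists_isMinOn hne h₁.1.continuousOn
    obtain ⟨b, hb, hbmin⟩ := isCompact_Icc.exists_isMinOn hne h₂.1.continuousOn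
    obtain ⟨a', ha', hamax⟩ := isCompact_Icc.exists_isMaxOn hne h₁.1.continuousOn
    obtain ⟨b', hb', hbmax⟩ := isCompact_Icc.exists_isMaxOn hne h₂.1.continuousOn
    obtain ⟨C, hC, hCL⟩ := hL (min (V₁ a) (V₂ b)) (max (V₁ a') (V₂ b'))
      (lt_min (hp₁ a ⟨ha.1, ha.2.trans_lt ht.2⟩) (hp₂ b ⟨hb.1, hb.2.trans_lt ht.2⟩))
    exact (h₁.mono ht.2.le).eqOn_of_lipschitz (h₂.mono ht.2.le) hf hC hCL
      (fun s hs => ⟨(min_le_left _ _).trans (hamin hs), (le_max_left _ _).trans' (hamax hs)⟩)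
      (fun s hs => ⟨(min_le_right _ _).trans (hbmin hs), (le_max_right _ _).trans' (hbmax hs)⟩)
      hV hW ⟨ht.1, le_rfl⟩
  have := key.closure h₁.1 h₂.1
  rwa [closure_Ico hT.ne] at this

/-- Scaling the variable by `l` costs one factor `l` in each equation. For `power p` the hypothesis
becomes `k ^ p = k * l ^ 2`, which leaves a one-parameter family of rescalings. -/
theorem rescale {g : ℝ → ℝ} (h : IsProfile f T V W) {k l : ℝ} (hl : 0 < l)
    (hfg : ∀ x, g (k * x) = k * l ^ 2 * f x) :
    IsProfile g (T / l) (fun t => k * V (l * t)) (fun t => k * l * W (l * t)) := by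
  have hmem : ∀ t ∈ Icc 0 (T / l), l * t ∈ Icc 0 T := fun t ht =>
    ⟨mul_nonneg hl.le ht.1, by rw [mul_comm]; exact (le_div_iff₀ hl).1 ht.2⟩
  refine ⟨by have := h.1; fun_prop, by have := h.2; fun_prop, fun t ht => ?_, fun t ht => ?_⟩
  · rw [pot_const_mul, mul_assoc, pot_comp_mul, h.3 _ (hmem t ht)]
    simp [mul_add]
  · simp only [hfg]
    rw [pot_const_mul, h.4 _ (hmem t ht), ← pot_comp_mul]
    simp only [mul_zero]
    ring

theorem trace_rescale (W : ℝ → ℝ) (c k l t : ℝ) :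
    trace c (fun t => k * W (l * t)) t = k * trace c W (l * t) := by
  simp only [trace, mean_const_mul, mean_comp_mul]
  ring

end IsProfile

/-- `V` is positive on `[0, T)`, vanishes at `T`, and has vanishing trace there. -/
structure IsSolution (c : ℝ) (f : ℝ → ℝ) (T : ℝ) (V W : ℝ → ℝ) : Prop
    extends IsProfile f T V W where
  pos : ∀ t ∈ Ico 0 T, 0 < V t
  fst_end : V T = 0
  trace_end : trace c W T = 0

/-! ### Strict decrease, and uniqueness for a given value at the origin -/

namespace IsSolution

variable {f : ℝ → ℝ} {c T T₁ T₂ : ℝ} {V W V₁ W₁ V₂ W₂ : ℝ → ℝ}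

/-- `mean W` is nondecreasing, so the endpoint decides. If `mean W T = 0`, then `W T = 0` by the
trace condition, hence `W ≤ 0` on `[0, T]`. As `W` has integral zero there, its integral over each
`[0, t]` is nonnegative, whence `V T ≥ V 0 > 0`, a contradiction. -/
theorem mean_snd_neg (h : IsSolution c f T V W) (hf : Continuous f) (hf0 : ∀ x, 0 ≤ f x)
    (hc : c < 1) (hT : 0 < T) {t : ℝ} (ht : t ∈ Icc 0 T) : mean W t < 0 := by
  have hTm : T ∈ Icc 0 T := ⟨hT.le, le_rfl⟩
  have hmono := monotoneOn_mean h.cont_snd (h.monotoneOn_snd hf hf0)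
  refine (hmono ht hTm ht.2).trans_lt ?_
  refine (h.mean_snd_nonpos hf hf0 hc hTm h.trace_end.le).lt_of_ne fun h0 => ?_
  have hWT : W T = 0 := by
    have := h.trace_end
    rw [trace, h0] at this
    linarith
  have hge : ∀ t ∈ Icc 0 T, 0 ≤ t * mean W t := fun t ht => by
    have h1 := mul_mean W T
    rw [h0, mul_zero, ← intervalIntegral.integral_add_adjacent_intervals (b := t)
      (h.cont_snd.intervalIntegrable 0 _) (h.cont_snd.intervalIntegrable _ T), ← mul_mean] at h1
    have h2 : 0 ≤ ∫ s in t..T, -W s := intervalIntegral.integral_nonneg ht.2 fun s hs => by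
      have := h.monotoneOn_snd hf hf0 ⟨ht.1.trans hs.1, hs.2⟩ hTm hs.2
      linarith
    rw [intervalIntegral.integral_neg] at h2
    linarith
  have hpot : 0 ≤ pot W T := by
    -- Only `s * mean W s ≥ 0` is known, which says nothing at `s = 0`; hence the almost everywhere
    -- form.
    refine intervalIntegral.integral_nonneg_of_ae_restrict hT.le ?_
    rw [Filter.EventuallyLE, ae_restrict_iff' measurableSet_Icc]
    filter_upwards [Measure.ae_ne volume 0] with s hs hs'
    exact nonneg_of_mul_nonneg_right (hge s hs') (hs'.1.lt_of_ne' hs)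
  have h3 := h.fst_eq T hTm
  have h4 := h.pos 0 ⟨le_rfl, hT⟩
  rw [h.fst_end] at h3
  linarith

theorem strictAntiOn (h : IsSolution c f T V W) (hf : Continuous f) (hf0 : ∀ x, 0 ≤ f x)
    (hc : c < 1) (hT : 0 < T) : StrictAntiOn V (Icc 0 T) := by
  refine strictAntiOn_of_hasDerivWithinAt_neg (f' := mean W) (convex_Icc 0 T)
    h.cont_fst.continuousOn (fun t ht => ?_) fun t ht => ?_
  · exact (h.hasDerivWithinAt_fst (interior_subset ht)).mono interior_subset
  · exact h.mean_snd_neg hf hf0 hc hT (interior_subset ht)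

/-- If `T₂ < T₁`, comparison gives `0 < V₁ T₂ ≤ V₂ T₂ = 0`. If `T₁ ≤ T₂`, then at `T₁` the second
trace exceeds the first, which is zero, and by monotonicity it cannot return to zero at `T₂`. -/
theorem not_snd_lt (h₁ : IsSolution c f T₁ V₁ W₁) (h₂ : IsSolution c f T₂ V₂ W₂)
    (hf : Continuous f) (hf0 : ∀ x, 0 ≤ f x) (hm : Monotone f) (hc : c < 1) (hT₁ : 0 < T₁)
    (hT₂ : 0 < T₂) (hV : V₁ 0 = V₂ 0) : ¬ W₁ 0 < W₂ 0 := fun hlt => by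
  rcases lt_or_ge T₂ T₁ with hT | hT
  · have h3 := ((h₁.toIsProfile.mono hT.le).comparison h₂.toIsProfile hf hm hV.le hlt).1 T₂
      ⟨hT₂.le, le_rfl⟩
    have h4 := h₁.pos T₂ ⟨hT₂.le, hT⟩
    rw [h₂.fst_end] at h3
    linarith
  · have h3 := h₁.toIsProfile.trace_lt_trace (h₂.toIsProfile.mono hT) hf hm hV.le hlt hc
      (t := T₁) ⟨hT₁.le, le_rfl⟩
    have h4 := h₂.monotoneOn_trace hf hf0 hc ⟨hT₁.le, hT⟩ ⟨hT₂.le, le_rfl⟩ hT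
    rw [h₁.trace_end] at h3
    rw [h₂.trace_end] at h4
    linarith

theorem eq_of_fst_zero_eq (h₁ : IsSolution c f T₁ V₁ W₁) (h₂ : IsSolution c f T₂ V₂ W₂)
    (hf : Continuous f) (hf0 : ∀ x, 0 ≤ f x) (hm : Monotone f)
    (hL : ∀ ε M : ℝ, 0 < ε → ∃ C, 0 ≤ C ∧ ∀ x ∈ Icc ε M, ∀ y ∈ Icc ε M,
      |f x - f y| ≤ C * |x - y|) (hc : c < 1) (hT₁ : 0 < T₁)
    (hT₂ : 0 < T₂) (hV : V₁ 0 = V₂ 0) : T₁ = T₂ ∧ EqOn V₁ V₂ (Icc 0 T₁) := by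
  have hW : W₁ 0 = W₂ 0 := le_antisymm
    (not_lt.1 (h₂.not_snd_lt h₁ hf hf0 hm hc hT₂ hT₁ hV.symm))
    (not_lt.1 (h₁.not_snd_lt h₂ hf hf0 hm hc hT₁ hT₂ hV))
  have key := (h₁.toIsProfile.mono (min_le_left T₁ T₂)).eqOn_of_pos
    (h₂.toIsProfile.mono (min_le_right T₁ T₂)) hf hL
    (fun t ht => h₁.pos t ⟨ht.1, ht.2.trans_le (min_le_left _ _)⟩)
    (fun t ht => h₂.pos t ⟨ht.1, ht.2.trans_le (min_le_right _ _)⟩) hV hW (lt_min hT₁ hT₂)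
  have hT : T₁ = T₂ := by
    rcases lt_trichotomy T₁ T₂ with hT | hT | hT
    · have h3 := h₂.pos T₁ ⟨hT₁.le, hT⟩
      rw [← key ⟨hT₁.le, (min_eq_left hT.le).ge⟩, h₁.fst_end] at h3
      exact absurd h3 (lt_irrefl _)
    · exact hT
    · have h3 := h₁.pos T₂ ⟨hT₂.le, hT⟩
      rw [key ⟨hT₂.le, (min_eq_right hT.le).ge⟩, h₂.fst_end] at h3
      exact absurd h3 (lt_irrefl _)
  refine ⟨hT, ?_⟩
  rwa [min_eq_left hT.le] at key

theorem rescale {g : ℝ → ℝ} (h : IsSolution c f T V W) {k l : ℝ} (hk : 0 < k) (hl : 0 < l)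
    (hfg : ∀ x, g (k * x) = k * l ^ 2 * f x) :
    IsSolution c g (T / l) (fun t => k * V (l * t)) (fun t => k * l * W (l * t)) where
  toIsProfile := h.toIsProfile.rescale hl hfg
  pos t ht := mul_pos hk <| h.pos _
    ⟨mul_nonneg hl.le ht.1, by rw [mul_comm]; exact (lt_div_iff₀ hl).1 ht.2⟩
  fst_end := by simp [mul_div_cancel₀ T hl.ne', h.fst_end]
  trace_end := by
    rw [IsProfile.trace_rescale, mul_div_cancel₀ T hl.ne', h.trace_end, mul_zero]

end IsSolution

/-- The nonlinearity, extended by zero to the negative half-line. -/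
noncomputable def power (p x : ℝ) : ℝ := max x 0 ^ p

/-! ### The power nonlinearity and uniqueness by scaling -/

section power

variable {p : ℝ}

theorem continuous_power (hp : 0 < p) : Continuous (power p) :=
  (continuous_id.max continuous_const).rpow_const fun _ => .inr hp.le

theorem power_nonneg (p x : ℝ) : 0 ≤ power p x := Real.rpow_nonneg (le_max_right _ _) _

theorem monotone_power (hp : 0 < p) : Monotone (power p) := fun _ _ hxy =>
  Real.rpow_le_rpow (le_max_right _ _) (max_le_max hxy le_rfl) hp.le

theorem power_of_nonneg {x : ℝ} (hx : 0 ≤ x) : power p x = x ^ p := by simp [power, hx]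

theorem power_mul {k : ℝ} (hk : 0 < k) (x : ℝ) : power p (k * x) = k ^ p * power p x := by
  rw [power, power, ← Real.mul_rpow hk.le (le_max_right _ _), mul_max_of_nonneg _ _ hk.le,
    mul_zero]

theorem exists_lipschitz_power (p ε M : ℝ) (hε : 0 < ε) :
    ∃ C, 0 ≤ C ∧ ∀ x ∈ Icc ε M, ∀ y ∈ Icc ε M, |power p x - power p y| ≤ C * |x - y| := by
  have hcd : ContDiffOn ℝ 1 (fun x : ℝ => x ^ p) (Icc ε M) := fun x hx =>
    (Real.contDiffAt_rpow_const_of_ne (hε.trans_le hx.1).ne').contDiffWithinAt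
  obtain ⟨K, hK⟩ := hcd.exists_lipschitzOnWith one_ne_zero (convex_Icc _ _) isCompact_Icc
  refine ⟨K, K.2, fun x hx y hy => ?_⟩
  rw [power_of_nonneg (hε.le.trans hx.1), power_of_nonneg (hε.le.trans hy.1)]
  simpa [Real.dist_eq] using hK.dist_le_mul x hx y hy

/-- Uniqueness for the boundary value problem. -/
theorem IsSolution.eqOn {c T : ℝ} {V₁ W₁ V₂ W₂ : ℝ → ℝ} (hp : 0 < p) (hp1 : p ≠ 1)
    (h₁ : IsSolution c (power p) T V₁ W₁) (h₂ : IsSolution c (power p) T V₂ W₂)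
    (hc : c < 1) (hT : 0 < T) : EqOn V₁ V₂ (Icc 0 T) := by
  have hV₁ := h₁.pos 0 ⟨le_rfl, hT⟩
  have hV₂ := h₂.pos 0 ⟨le_rfl, hT⟩
  set k := V₁ 0 / V₂ 0
  have hk : 0 < k := div_pos hV₁ hV₂
  -- This solves `k ^ p = k * l ^ 2`, so the second solution rescales to one with value `V₁ 0` at
  -- the origin and endpoint `T / l`.
  set l := k ^ ((p - 1) / 2)
  have hl : 0 < l := Real.rpow_pos_of_pos hk _
  have hkl : k ^ p = k * l ^ 2 := by
    rw [← Real.rpow_natCast l, ← Real.rpow_mul hk.le]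
    nth_rewrite 2 [← Real.rpow_one k]
    rw [← Real.rpow_add hk]
    congr 1
    push_cast
    ring
  have h₃ := h₂.rescale (g := power p) hk hl fun x => by rw [power_mul hk, hkl]
  obtain ⟨h4, h5⟩ := h₁.eq_of_fst_zero_eq h₃ (continuous_power hp) (power_nonneg p)
    (monotone_power hp) (exists_lipschitz_power p) hc hT (div_pos hT hl)
    (by simp [k, hV₂.ne'])
  have hl1 : l = 1 := by
    rw [eq_div_iff hl.ne'] at h4
    exact mul_left_cancel₀ hT.ne' (h4.trans (mul_one T).symm)
  have hk1 : k = 1 := by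
    refine (Real.rpow_left_inj hk.le zero_le_one
      (div_ne_zero (sub_ne_zero.2 hp1) two_ne_zero)).1 (hl1.trans ?_)
    rw [Real.one_rpow]
  intro t ht
  simpa [hl1, hk1] using h5 ht

end power

end Steklov

namespace Steklov

open MeasureTheory Filter Topology

/-! ### Existence by shooting -/

section shooting

variable {f : ℝ → ℝ} {L : ℝ}

/-- One step of the Picard iteration for the profile with `V 0 = 1`, `W 0 = β`. -/
noncomputable def picard (f : ℝ → ℝ) (β : ℝ) (Z : ℝ → ℝ) (t : ℝ) : ℝ :=
  1 + pot (fun s => β + pot (fun r => f (Z r)) s) t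

theorem continuous_picard (hf : Continuous f) (β : ℝ) {Z : ℝ → ℝ} (hZ : Continuous Z) :
    Continuous (picard f β Z) :=
  continuous_const.add (continuous_pot (continuous_const.add (continuous_pot (hf.comp hZ))))

theorem picard_mono (hf : Continuous f) (hm : Monotone f) (β : ℝ) {Z Z' : ℝ → ℝ}
    (hZ : Continuous Z) (hZ' : Continuous Z') {t : ℝ} (ht : 0 ≤ t)
    (H : ∀ s ∈ Icc 0 t, Z s ≤ Z' s) : picard f β Z t ≤ picard f β Z' t := by
  refine add_le_add le_rfl (pot_mono ?_ ?_ ht fun s hs => add_le_add le_rfl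
    (pot_mono (hf.comp hZ) (hf.comp hZ') hs.1 fun r hr => hm (H r ⟨hr.1, hr.2.trans hs.2⟩)))
  · exact continuous_const.add (continuous_pot (hf.comp hZ))
  · exact continuous_const.add (continuous_pot (hf.comp hZ'))

/-- A pointwise limit of approximate profiles is a profile. -/
theorem exists_limit_profile (hf : Continuous f) (hf1 : ∀ x, |f x| ≤ 1)
    (hL : 0 ≤ L) {Z : ℕ → ℝ → ℝ} (hZ : ∀ n, Continuous (Z n)) {b : ℕ → ℝ} {β : ℝ}
    (hb : Tendsto b atTop (𝓝 β)) {X : ℝ → ℝ}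
    (hX : ∀ t ∈ Icc 0 L, Tendsto (fun n => Z n t) atTop (𝓝 (X t)))
    (hX' : ∀ t ∈ Icc 0 L, Tendsto (fun n => picard f (b n) (Z n) t) atTop (𝓝 (X t))) :
    ∃ V W, IsProfile f L V W ∧ V 0 = 1 ∧ W 0 = β ∧ (∀ t ∈ Icc 0 L, V t = X t) ∧
      ∀ c, ∀ t ∈ Icc 0 L, Tendsto
        (fun n => trace c (fun s => b n + pot (fun r => f (Z n r)) s) t) atTop
        (𝓝 (trace c W t)) := by
  obtain ⟨B, hB⟩ := hb.abs.bddAbove_range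
  replace hB : ∀ n, |b n| ≤ B := fun n => hB ⟨n, rfl⟩
  set Y : ℕ → ℝ → ℝ := fun n s => b n + pot (fun r => f (Z n r)) s
  have hfZ : ∀ n, Continuous fun r => f (Z n r) := fun n => hf.comp (hZ n)
  have hY : ∀ n, Continuous (Y n) := fun n => continuous_const.add (continuous_pot (hfZ n))
  have hYB : ∀ n, ∀ s ∈ Icc 0 L, |Y n s| ≤ B + L := fun n s hs => by
    refine (abs_add_le _ _).trans (add_le_add (hB n) ?_)
    rw [abs_le]
    have h1 := pot_mono (hfZ n) (continuous_const (y := (1 : ℝ))) hs.1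
      fun r _ => (abs_le.1 (hf1 (Z n r))).2
    have h2 := pot_mono (continuous_const (y := (-1 : ℝ))) (hfZ n) hs.1
      fun r _ => (abs_le.1 (hf1 (Z n r))).1
    rw [pot_const] at h1 h2
    constructor <;> linarith [hs.2]
  have hBL : 0 ≤ B + L := add_nonneg ((abs_nonneg _).trans (hB 0)) hL
  -- The bound is uniform in `n`, so the pointwise limit `X` is Lipschitz. Its continuity allows an
  -- extension to the line and the passage to the limit in both integral equations by dominated
  -- convergence.
  have hlip : ∀ n, ∀ s ∈ Icc 0 L, ∀ t ∈ Icc 0 L,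
      |picard f (b n) (Z n) s - picard f (b n) (Z n) t| ≤ (B + L) * |s - t| := by
    intro n s hs t ht
    have := (convex_Icc 0 L).norm_image_sub_le_of_norm_hasDerivWithin_le (f := pot (Y n))
      (fun r _ => (hasDerivAt_pot (hY n) r).hasDerivWithinAt) (fun r hr => abs_mean_le (hY n) hr.1
        fun q hq => hYB n q ⟨hq.1, hq.2.trans hr.2⟩) ht hs
    simpa [picard, Real.norm_eq_abs] using this
  have hXlip : ∀ s ∈ Icc 0 L, ∀ t ∈ Icc 0 L, |X s - X t| ≤ (B + L) * |s - t| := fun s hs t ht =>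
    le_of_tendsto ((hX' s hs).sub (hX' t ht)).abs (.of_forall fun n => hlip n s hs t ht)
  have hXc : ContinuousOn X (Icc 0 L) :=
    (LipschitzOnWith.of_dist_le_mul (K := ⟨B + L, hBL⟩)
      fun s hs t ht => hXlip s hs t ht).continuousOn
  set X' : ℝ → ℝ := IccExtend hL ((Icc 0 L).domRestrict X)
  have hX'c : Continuous X' := (continuousOn_iff_continuous_domRestrict.1 hXc).Icc_extend'
  have hX'X : ∀ t ∈ Icc 0 L, X' t = X t := fun t ht => by
    simp [X', IccExtend_of_mem hL _ ht]
  set W : ℝ → ℝ := fun s => β + pot (fun r => f (X' r)) s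
  have hWc : Continuous W := continuous_const.add (continuous_pot (hf.comp hX'c))
  have hYW : ∀ s ∈ Icc 0 L, Tendsto (fun n => Y n s) atTop (𝓝 (W s)) := fun s hs =>
    hb.add <| tendsto_pot hfZ hs.1 (fun n r _ => hf1 _) fun r hr => by
      have hr' : r ∈ Icc 0 L := ⟨hr.1, hr.2.trans hs.2⟩
      rw [hX'X r hr']
      exact (hf.tendsto _).comp (hX r hr')
  have hVX : ∀ t ∈ Icc 0 L, 1 + pot W t = X t := fun t ht =>
    tendsto_nhds_unique (tendsto_const_nhds.add <| tendsto_pot hY ht.1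
      (fun n s hs => hYB n s ⟨hs.1, hs.2.trans ht.2⟩)
      fun s hs => hYW s ⟨hs.1, hs.2.trans ht.2⟩) (hX' t ht)
  refine ⟨fun t => 1 + pot W t, W, ⟨continuous_const.add (continuous_pot hWc), hWc,
    fun t _ => by simp [pot_zero], fun t ht => ?_⟩, by simp [pot_zero], by simp [W, pot_zero],
    hVX, fun c t ht => ?_⟩
  · simp only [W, pot_zero, add_zero]
    congr 1
    refine pot_congr ht.1 fun s hs => ?_
    have hs' : s ∈ Icc 0 L := ⟨hs.1, hs.2.trans ht.2⟩
    change f (X' s) = f (1 + pot W s)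
    rw [hX'X s hs', hVX s hs']
  · exact (hYW t ht).sub <| tendsto_const_nhds.mul <| tendsto_mean hY ht.1
      (fun n s hs => hYB n s ⟨hs.1, hs.2.trans ht.2⟩) fun s hs => hYW s ⟨hs.1, hs.2.trans ht.2⟩

theorem exists_profile (hf : Continuous f) (hm : Monotone f) (hf0 : ∀ x, 0 ≤ f x)
    (hf1 : ∀ x, f x ≤ 1) (hL : 0 ≤ L) (β : ℝ) :
    ∃ V W, IsProfile f L V W ∧ V 0 = 1 ∧ W 0 = β := by
  set X : ℕ → ℝ → ℝ := fun n => (picard f β)^[n] fun t => 1 + t * β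
  have hXs : ∀ n, X (n + 1) = picard f β (X n) := fun n => Function.iterate_succ_apply' _ _ _
  have hXc : ∀ n, Continuous (X n) := fun n => by
    induction n with
    | zero => exact (by fun_prop : Continuous fun t : ℝ => 1 + t * β)
    | succ n ih => rw [hXs]; exact continuous_picard hf β ih
  -- The starting function `1 + t β` lies below its Picard image because `f ≥ 0`, and the Picard map
  -- is monotone; `f ≤ 1` bounds the iterates. No Lipschitz condition is needed.
  have hmono : ∀ n, ∀ t, 0 ≤ t → X n t ≤ X (n + 1) t := fun n => by
    induction n with
    | zero =>
      intro t ht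
      rw [hXs, picard, pot_add_const (g := pot fun r => f (X 0 r))
        (continuous_pot (hf.comp (hXc 0)))]
      have : 0 ≤ pot (pot fun r => f (X 0 r)) t :=
        pot_nonneg (continuous_pot (hf.comp (hXc 0))) ht fun s hs =>
          pot_nonneg (hf.comp (hXc 0)) hs.1 fun r _ => hf0 _
      change 1 + t * β ≤ 1 + (t * β + pot (pot fun r => f (X 0 r)) t)
      linarith
    | succ n ih =>
      intro t ht
      rw [hXs, hXs (n + 1)]
      exact picard_mono hf hm β (hXc _) (hXc _) ht fun s hs => ih s hs.1
  have hbdd : ∀ n, ∀ t, 0 ≤ t → X n t ≤ picard (fun _ => 1) β (fun _ => 0) t := fun n t ht => by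
    refine (hmono n t ht).trans ?_
    rw [hXs, picard, picard]
    refine add_le_add le_rfl (pot_mono (continuous_const.add (continuous_pot (hf.comp (hXc n))))
      (continuous_const.add (continuous_pot continuous_const)) ht fun s hs => ?_)
    exact add_le_add le_rfl (pot_mono (hf.comp (hXc n)) continuous_const hs.1 fun r _ => hf1 _)
  have hlim : ∀ t ∈ Icc 0 L, Tendsto (fun n => X n t) atTop (𝓝 (⨆ n, X n t)) := fun t ht =>
    tendsto_atTop_ciSup (monotone_nat_of_le_succ fun n => hmono n t ht.1)
      ⟨_, by rintro _ ⟨n, rfl⟩; exact hbdd n t ht.1⟩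
  obtain ⟨V, W, h, hV, hW, -⟩ := exists_limit_profile hf
    (fun x => (abs_of_nonneg (hf0 x)).le.trans (hf1 x)) hL hXc (tendsto_const_nhds (x := β)) hlim
    fun t ht => by
      simp_rw [← hXs]
      exact (hlim t ht).comp (tendsto_add_atTop_nat 1)
  exact ⟨V, W, h, hV, hW⟩

theorem IsProfile.picard_eq {V W : ℝ → ℝ} (h : IsProfile f L V W)
    (hV : V 0 = 1) {t : ℝ} (ht : t ∈ Icc 0 L) : picard f (W 0) V t = V t := by
  rw [picard, h.3 t ht, hV]
  congr 1
  exact pot_congr ht.1 fun s hs => (h.4 s ⟨hs.1, hs.2.trans ht.2⟩).symm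

/-- A monotone bounded family of profiles converges to a profile. -/
theorem exists_limit_of_profiles (hf : Continuous f) (hf1 : ∀ x, |f x| ≤ 1) (hL : 0 ≤ L)
    {V W : ℕ → ℝ → ℝ} (h : ∀ n, IsProfile f L (V n) (W n)) (hV : ∀ n, V n 0 = 1) {β : ℝ}
    (hb : Tendsto (fun n => W n 0) atTop (𝓝 β))
    (hX : ∀ t ∈ Icc 0 L, ∃ x, Tendsto (fun n => V n t) atTop (𝓝 x)) :
    ∃ P Q, IsProfile f L P Q ∧ P 0 = 1 ∧ Q 0 = β ∧
      (∀ t ∈ Icc 0 L, Tendsto (fun n => V n t) atTop (𝓝 (P t))) ∧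
      ∀ c, ∀ t ∈ Icc 0 L, Tendsto (fun n => trace c (W n) t) atTop (𝓝 (trace c Q t)) := by
  choose! X hX using hX
  obtain ⟨P, Q, h1, h2, h3, h4, h5⟩ := exists_limit_profile hf hf1 hL (fun n => (h n).1) hb hX
    fun t ht => by simpa only [(h _).picard_eq (hV _) ht] using hX t ht
  refine ⟨P, Q, h1, h2, h3, fun t ht => by rw [h4 t ht]; exact hX t ht, fun c t ht => ?_⟩
  refine (h5 c t ht).congr fun n => ?_
  rw [trace, trace, (h n).4 t ht,
    mean_congr ht.1 fun s hs => ((h n).4 s ⟨hs.1, hs.2.trans ht.2⟩).symm]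

theorem IsProfile.add_mul_le {V W : ℝ → ℝ} {t : ℝ} (h : IsProfile f L V W) (hf : Continuous f)
    (hf0 : ∀ x, 0 ≤ f x) (ht : t ∈ Icc 0 L) : V 0 + W 0 * t ≤ V t := by
  rw [h.3 t ht]
  have := pot_mono (continuous_const (y := W 0)) h.2 ht.1 fun s hs =>
    h.monotoneOn_snd hf hf0 ⟨le_rfl, ht.1.trans ht.2⟩ ⟨hs.1, hs.2.trans ht.2⟩ hs.1
  rw [pot_const] at this
  linarith

/-- Over a long enough interval the trace of every profile becomes positive. -/
theorem exists_trace_pos (hf : Continuous f) (hm : Monotone f) (hf0 : ∀ x, 0 ≤ f x)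
    (hpos : ∀ x, 0 < x → 0 < f x) {c : ℝ} (hc : c < 1) (β₀ : ℝ) (hβ₀ : β₀ < 0) :
    ∃ L, 1 ≤ L ∧ ∀ V W, IsProfile f L V W → V 0 = 1 → β₀ ≤ W 0 → 0 < trace c W L := by
  set η := f (1 / 2)
  have hη : 0 < η := hpos _ (by norm_num)
  -- Chosen so that `V t ≥ 1 + β₀ t ≥ 1 / 2`, hence `f (V t) ≥ η`, on `[0, τ]`. This gives `W' s ≥ δ
  -- / s` for `s ≥ 1`, with `δ = τ * η`.
  set τ := min 1 (1 / (2 * -β₀))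
  have hτ : 0 < τ := lt_min one_pos (by apply div_pos one_pos; linarith)
  have hτ1 : τ ≤ 1 := min_le_left _ _
  have hτβ : -β₀ * τ ≤ 1 / 2 := by
    calc -β₀ * τ ≤ -β₀ * (1 / (2 * -β₀)) :=
          mul_le_mul_of_nonneg_left (min_le_right _ _) (by linarith)
      _ = 1 / 2 := by field_simp [hβ₀.ne]
  set δ := τ * η
  have hδ : 0 < δ := mul_pos hτ hη
  -- The logarithmic growth of `W` then yields `W ≥ 2 - β₀` on `[L / 2, L]`, which outweighs `W ≥
  -- β₀` on the first half. So `mean W L > 0`, whereas a nonpositive trace would force `mean W L ≤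
  -- 0`.
  set L := 2 * Real.exp (2 * (1 - β₀) / δ)
  have he : 1 ≤ Real.exp (2 * (1 - β₀) / δ) :=
    Real.one_le_exp (div_nonneg (by linarith) hδ.le)
  have hL : 2 ≤ L := by simp only [L]; linarith
  refine ⟨L, by linarith, fun V W h hV hW => ?_⟩
  by_contra! hcon
  have hLm : L ∈ Icc 0 L := ⟨by linarith, le_rfl⟩
  have hmean := h.mean_snd_nonpos hf hf0 hc hLm hcon
  have hfc := h.continuous_comp hf
  have hδle : ∀ s, 1 ≤ s → s ≤ L → δ / s ≤ mean (fun r => f (V r)) s := by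
    intro s hs1 hsL
    have hs0 : 0 < s := by linarith
    rw [div_le_iff₀' hs0, mul_mean,
      ← intervalIntegral.integral_add_adjacent_intervals (b := τ)
      (hfc.intervalIntegrable 0 _) (hfc.intervalIntegrable _ s)]
    have h1 : 0 ≤ ∫ r in τ..s, f (V r) :=
      intervalIntegral.integral_nonneg (hτ1.trans hs1) fun r _ => hf0 _
    have h2 : ∫ _ in (0 : ℝ)..τ, η ≤ ∫ r in (0 : ℝ)..τ, f (V r) := by
      refine intervalIntegral.integral_mono_on hτ.le (by simp) (hfc.intervalIntegrable _ _)
        fun r hr => hm ?_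
      have h3 := h.add_mul_le hf hf0 (t := r) ⟨hr.1, hr.2.trans (hτ1.trans (hs1.trans hsL))⟩
      have h4 : β₀ * τ ≤ W 0 * r := by nlinarith [hr.1, hr.2]
      linarith
    simp only [intervalIntegral.integral_const, sub_zero, smul_eq_mul] at h2
    linarith
  have hWL : W 0 + δ * Real.log (L / 2) ≤ W (L / 2) := by
    have h1 : (1 : ℝ) ≤ L / 2 := by linarith
    rw [h.4 (L / 2) ⟨by linarith, by linarith⟩, pot]
    have hmc := continuous_mean hfc
    rw [← intervalIntegral.integral_add_adjacent_intervals (b := 1)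
      (hmc.intervalIntegrable 0 _) (hmc.intervalIntegrable _ (L / 2))]
    have h2 : 0 ≤ ∫ s in (0 : ℝ)..1, mean (fun r => f (V r)) s :=
      intervalIntegral.integral_nonneg zero_le_one fun r hr =>
        const_le_mean hfc hr.1 fun _ _ => hf0 _
    have hci : IntervalIntegrable (fun s => δ * s⁻¹) volume 1 (L / 2) := by
      refine (ContinuousOn.intervalIntegrable ?_)
      refine continuousOn_const.mul (continuousOn_inv₀.mono fun s hs => ?_)
      rw [uIcc_of_le h1] at hs
      exact (one_pos.trans_le hs.1).ne'
    have h3 := intervalIntegral.integral_mono_on h1 hci (hmc.intervalIntegrable _ _)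
      fun s hs => (div_eq_mul_inv δ s).symm.le.trans (hδle s hs.1 (by linarith [hs.2]))
    rw [intervalIntegral.integral_const_mul, integral_inv_of_pos one_pos (by linarith),
      div_one] at h3
    linarith
  have hlog : δ * Real.log (L / 2) = 2 * (1 - β₀) := by
    simp only [L]
    rw [mul_div_cancel_left₀ _ two_ne_zero, Real.log_exp]
    field_simp
  have hWm := h.monotoneOn_snd hf hf0
  have hint : 0 < ∫ s in (0 : ℝ)..L, W s := by
    rw [← intervalIntegral.integral_add_adjacent_intervals (b := L / 2)
      (h.2.intervalIntegrable 0 _) (h.2.intervalIntegrable _ L)]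
    have h1 : ∫ _ in (0 : ℝ)..L / 2, β₀ ≤ ∫ s in (0 : ℝ)..L / 2, W s := by
      refine intervalIntegral.integral_mono_on (by linarith) (by simp)
        (h.2.intervalIntegrable _ _) fun r hr => hW.trans ?_
      exact hWm ⟨le_rfl, hLm.1⟩ ⟨hr.1, by linarith [hr.2]⟩ hr.1
    have h2 : ∫ _ in L / 2..L, (2 - β₀) ≤ ∫ s in L / 2..L, W s := by
      refine intervalIntegral.integral_mono_on (by linarith) (by simp)
        (h.2.intervalIntegrable _ _) fun r hr => le_trans ?_
          (hWm (a := L / 2) ⟨by linarith, by linarith⟩ ⟨by linarith [hr.1], hr.2⟩ hr.1)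
      linarith
    simp only [intervalIntegral.integral_const, smul_eq_mul] at h1 h2
    nlinarith
  rw [← mul_mean] at hint
  nlinarith

/-- Shooting: for a bounded nonlinearity some profile with `V 0 = 1` solves the boundary value
problem on some interval. -/
theorem exists_isSolution_of_bounded (hf : Continuous f) (hm : Monotone f) (hf0 : ∀ x, 0 ≤ f x)
    (hf1 : ∀ x, f x ≤ 1) (hpos : ∀ x, 0 < x → 0 < f x)
    (hLip : ∀ ε M : ℝ, 0 < ε → ∃ C, 0 ≤ C ∧ ∀ x ∈ Icc ε M, ∀ y ∈ Icc ε M,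
      |f x - f y| ≤ C * |x - y|) {c : ℝ} (hc : c < 1) :
    ∃ T V W, 0 < T ∧ IsSolution c f T V W ∧ V 0 = 1 := by
  have hf1' : ∀ x, |f x| ≤ 1 := fun x => (abs_of_nonneg (hf0 x)).le.trans (hf1 x)
  -- Negative enough for `V` and the trace to be nonpositive at `t = 1`: there `β₀ ≤ mean W ≤ β₀ +
  -- 1` and `W ≤ β₀ + 1`, and `(1 - c) * β₀ + 1 ≤ 0` covers the case `c ≥ 0`.
  set β₀ : ℝ := -3 - 1 / (1 - c)
  have hc' : 0 < 1 / (1 - c) := one_div_pos.2 (sub_pos.2 hc)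
  have hβ₀ : β₀ < 0 := by simp only [β₀]; linarith
  obtain ⟨L, hL1, hLtr⟩ := exists_trace_pos hf hm hf0 hpos hc β₀ hβ₀
  have hL : 0 ≤ L := zero_le_one.trans hL1
  choose V W h hV hW using exists_profile hf hm hf0 hf1 hL
  have hVle : ∀ {a b t}, a ≤ b → t ∈ Icc 0 L → V a t ≤ V b t := by
    intro a b t hab ht
    rcases hab.eq_or_lt with rfl | hab
    · rfl
    · exact ((h a).comparison (h b) hf hm (by rw [hV, hV]) (by rwa [hW, hW])).1 t ht
  have htrle : ∀ {a b t}, a ≤ b → t ∈ Icc 0 L → trace c (W a) t ≤ trace c (W b) t := by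
    intro a b t hab ht
    rcases hab.eq_or_lt with rfl | hab
    · rfl
    · exact ((h a).trace_lt_trace (h b) hf hm (by rw [hV, hV]) (by rwa [hW, hW]) hc ht).le
  set S : Set ℝ := {β | ∃ t ∈ Icc 0 L, V β t ≤ 0 ∧ trace c (W β) t ≤ 0}
  have hSne : β₀ ∈ S := by
    have hm1 : (1 : ℝ) ∈ Icc 0 L := ⟨zero_le_one, hL1⟩
    have hWle : ∀ s ∈ Icc (0 : ℝ) 1, W β₀ s ≤ β₀ + 1 := fun s hs => by
      rw [(h β₀).4 s ⟨hs.1, hs.2.trans hL1⟩, hW]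
      have := pot_mono ((h β₀).continuous_comp hf) (continuous_const (y := (1 : ℝ))) hs.1
        fun r _ => hf1 _
      rw [pot_const] at this
      linarith [hs.2]
    refine ⟨1, hm1, ?_, ?_⟩
    · rw [(h β₀).3 1 hm1, hV]
      have := pot_mono (h β₀).2 (continuous_const (y := β₀ + 1)) zero_le_one hWle
      rw [pot_const] at this
      simp only [β₀] at this ⊢
      linarith
    · have h1 := hWle 1 ⟨zero_le_one, le_rfl⟩
      have h2 := mean_le_const (h β₀).2 zero_le_one hWle
      have h3 := le_mean_of_monotoneOn (h β₀).2 ((h β₀).monotoneOn_snd hf hf0) hm1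
      rw [hW] at h3
      have h4 : (1 - c) * β₀ = -3 * (1 - c) - 1 := by
        simp only [β₀]
        field_simp [(sub_pos.2 hc).ne']
      unfold trace
      rcases le_total c 0 with h0 | h0
      · have : β₀ + 1 < 0 := by simp only [β₀]; linarith
        nlinarith
      · nlinarith
  have hSbdd : BddAbove S := ⟨0, fun β hβ => by
    obtain ⟨t, ht, h1, -⟩ := hβ
    by_contra! hlt
    have := (h β).add_mul_le hf hf0 ht
    rw [hV, hW] at this
    nlinarith [ht.1]⟩
  set β := sSup S
  have hβ₀β : β₀ ≤ β := le_csSup hSbdd hSne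
  -- approach `β` from below, inside `S`
  obtain ⟨u, hu, huS, hut, huS'⟩ :=
    (isLUB_csSup ⟨β₀, hSne⟩ hSbdd).exists_seq_monotone_tendsto ⟨β₀, hSne⟩
  obtain ⟨P, Q, hPQ, hP0, hQ0, hPlim, hQlim⟩ := exists_limit_of_profiles hf hf1' hL
    (fun n => h (u n)) (fun n => hV _) (β := β) (by simpa only [hW] using hut) fun t ht =>
      ⟨_, tendsto_atTop_ciSup (fun m n hmn => hVle (hu hmn) ht)
        ⟨V β t, by rintro _ ⟨n, rfl⟩; exact hVle (huS n) ht⟩⟩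
  have hPle : ∀ t ∈ Icc 0 L, P t ≤ V β t := fun t ht =>
    le_of_tendsto' (hPlim t ht) fun n => hVle (huS n) ht
  -- The sets of admissible `t` are compact and decrease with `n`, since `V` and the trace increase
  -- with `β`; a common point survives in the limit.
  obtain ⟨t₀, ht₀L, ht₀⟩ : ∃ t ∈ Icc 0 L, ∀ n, V (u n) t ≤ 0 ∧ trace c (W (u n)) t ≤ 0 := by
    set A : ℕ → Set ℝ := fun n => Icc 0 L ∩ {t | V (u n) t ≤ 0 ∧ trace c (W (u n)) t ≤ 0}
    have hAc : ∀ n, IsClosed {t | V (u n) t ≤ 0 ∧ trace c (W (u n)) t ≤ 0} := fun n =>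
      (isClosed_le (h _).1 continuous_const).inter
        (isClosed_le (continuous_trace c (h _).2) continuous_const)
    obtain ⟨t, ht⟩ := IsCompact.nonempty_iInter_of_sequence_nonempty_isCompact_isClosed A
      (fun n t ht => ⟨ht.1, (hVle (hu n.le_succ) ht.1).trans ht.2.1,
        (htrle (hu n.le_succ) ht.1).trans ht.2.2⟩)
      (fun n => (huS' n).imp fun t ht => ht)
      (isCompact_Icc.inter_right (hAc 0)) fun n => isClosed_Icc.inter (hAc n)
    rw [mem_iInter] at ht
    exact ⟨t, (ht 0).1, fun n => (ht n).2⟩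
  have hPt₀ : P t₀ ≤ 0 := le_of_tendsto' (hPlim t₀ ht₀L) fun n => (ht₀ n).1
  have hQt₀ : trace c Q t₀ ≤ 0 := le_of_tendsto' (hQlim c t₀ ht₀L) fun n => (ht₀ n).2
  -- the first zero of the limit
  obtain ⟨T, ⟨hTL, hPT⟩, hTmin⟩ := (isCompact_Icc.inter_right
    (isClosed_le hPQ.1 continuous_const)).exists_isLeast (s := Icc 0 L ∩ {t | P t ≤ 0})
      ⟨t₀, ht₀L, hPt₀⟩
  have hT : 0 < T := hTL.1.lt_of_ne fun h0 => by
    rw [← h0, mem_ofPred_eq, hP0] at hPT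
    linarith
  have hPpos : ∀ t ∈ Ico 0 T, 0 < P t := fun t ht => by
    by_contra! hle
    exact absurd (hTmin ⟨⟨ht.1, ht.2.le.trans hTL.2⟩, hle⟩) (not_le.2 ht.2)
  have hPT0 : P T = 0 := by
    refine le_antisymm hPT ?_
    have : closure (Ico 0 T) ⊆ {t | 0 ≤ P t} :=
      closure_minimal (fun t ht => (hPpos t ht).le) (isClosed_le continuous_const hPQ.1)
    rw [closure_Ico hT.ne] at this
    exact this ⟨hT.le, le_rfl⟩
  -- The first zero comes no later than `t₀`, and the trace is nondecreasing.
  have hQT : trace c Q T ≤ 0 :=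
    (hPQ.monotoneOn_trace hf hf0 hc hTL ht₀L (hTmin ⟨ht₀L, hPt₀⟩)).trans hQt₀
  refine ⟨T, P, Q, hT, ⟨hPQ.mono hTL.2, hPpos, hPT0, hQT.antisymm ?_⟩, hP0⟩
  by_contra! hneg
  have hTL' : T < L := hTL.2.lt_of_ne fun h0 => by
    have := hLtr P Q hPQ hP0 (by rwa [hQ0])
    rw [← h0] at this
    linarith
  -- approach `β` from above
  have hv : Tendsto (fun n : ℕ => β + 1 / ((n : ℝ) + 1)) atTop (𝓝 β) := by
    simpa using tendsto_const_nhds.add (tendsto_one_div_add_atTop_nhds_zero_nat (𝕜 := ℝ))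
  have hvβ : ∀ n : ℕ, β < β + 1 / ((n : ℝ) + 1) := fun n => by
    have : 0 < 1 / ((n : ℝ) + 1) := by positivity
    linarith
  obtain ⟨P', Q', hPQ', hP0', hQ0', hPlim', hQlim'⟩ := exists_limit_of_profiles hf hf1' hL
    (fun n : ℕ => h (β + 1 / ((n : ℝ) + 1))) (fun n => hV _) (β := β)
    (by simpa only [hW] using hv) fun t ht =>
      ⟨_, tendsto_atTop_ciInf (fun m n hmn => hVle (by gcongr) ht)
        ⟨V β t, by rintro _ ⟨n, rfl⟩; exact hVle (hvβ n).le ht⟩⟩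
  have hleP' : ∀ t ∈ Icc 0 L, V β t ≤ P' t := fun t ht =>
    ge_of_tendsto' (hPlim' t ht) fun n => hVle (hvβ n).le ht
  -- The sandwich `P ≤ V β ≤ P'` keeps `P'` positive before `T`, where uniqueness applies.
  have heq : EqOn P P' (Icc 0 T) := (hPQ.mono hTL.2).eqOn_of_pos (hPQ'.mono hTL.2) hf hLip hPpos
    (fun t ht => (hPpos t ht).trans_le <|
      have ht' : t ∈ Icc 0 L := ⟨ht.1, ht.2.le.trans hTL.2⟩
      (hPle t ht').trans (hleP' t ht')) (hP0.trans hP0'.symm) (hQ0.trans hQ0'.symm) hT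
  have hQeq : ∀ t ∈ Icc 0 T, Q' t = Q t := fun t ht => by
    have ht' : t ∈ Icc 0 L := ⟨ht.1, ht.2.trans hTL.2⟩
    rw [hPQ.4 t ht', hPQ'.4 t ht', hQ0, hQ0']
    congr 1
    exact pot_congr ht.1 fun s hs => by rw [heq ⟨hs.1, hs.2.trans ht.2⟩]
  have hP'T : P' T = 0 := (heq ⟨hT.le, le_rfl⟩).symm.trans hPT0
  have hQ'T : trace c Q' T < 0 := by
    rwa [trace, hQeq T ⟨hT.le, le_rfl⟩, mean_congr hT.le hQeq]
  have hmeanT : mean Q' T < 0 := by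
    have := mean_le_of_monotoneOn hPQ'.2 (hPQ'.monotoneOn_snd hf hf0) hTL
    unfold trace at hQ'T
    nlinarith
  have hd : HasDerivAt (fun t => P' 0 + pot Q' t) (mean Q' T) T :=
    (hasDerivAt_pot hPQ'.2 T).const_add _
  -- A negative trace at `T` gives `mean Q' T < 0`, so just after `T` both `P'` and its trace are
  -- negative. The same then holds for profiles with `β` slightly above the supremum of `S`, which
  -- is impossible.
  have ev1 : ∀ᶠ t in 𝓝[>] T, slope (fun t => P' 0 + pot Q' t) T t < 0 :=
    ((hasDerivAt_iff_tendsto_slope.1 hd).eventually (gt_mem_nhds hmeanT)).filter_mono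
      (nhdsWithin_mono _ fun t ht => ne_of_gt ht)
  have ev2 : ∀ᶠ t in 𝓝[>] T, trace c Q' t < 0 :=
    ((continuous_trace c hPQ'.2).tendsto T |>.eventually (gt_mem_nhds hQ'T)).filter_mono
      nhdsWithin_le_nhds
  obtain ⟨t, ⟨ht1, ht2⟩, htT, htL⟩ := ((ev1.and ev2).and (Ioo_mem_nhdsGT hTL')).exists
  have htm : t ∈ Icc 0 L := ⟨hT.le.trans htT.le, htL.le⟩
  have hP't : P' t < 0 := by
    rw [slope_def_field, ← hPQ'.3 t htm, ← hPQ'.3 T hTL, hP'T, sub_zero] at ht1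
    by_contra! hle
    exact absurd ht1 (not_lt.2 (div_nonneg hle (sub_nonneg.2 htT.le)))
  obtain ⟨n, hn1, hn2⟩ := (((hPlim' t htm).eventually (gt_mem_nhds hP't)).and
    ((hQlim' c t htm).eventually (gt_mem_nhds ht2))).exists
  exact absurd (le_csSup hSbdd ⟨t, htm, hn1.le, hn2.le⟩) (not_le.2 (hvβ n))

end shooting

/-- Existence for the boundary value problem. -/
theorem exists_isSolution {p c T : ℝ} (hp : 0 < p) (hp1 : p ≠ 1) (hc : c < 1) (hT : 0 < T) :
    ∃ V W, IsSolution c (power p) T V W := by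
  set f : ℝ → ℝ := fun x => power p (min x 1)
  have hf : Continuous f := (continuous_power hp).comp (continuous_id.min continuous_const)
  have hf0 : ∀ x, 0 ≤ f x := fun x => power_nonneg _ _
  obtain ⟨T₁, V, W, hT₁, h, hV⟩ := exists_isSolution_of_bounded hf
    (fun x y hxy => monotone_power hp (min_le_min_right 1 hxy)) hf0
    (fun x => Real.rpow_le_one (le_max_right _ _) (max_le (min_le_right _ _) zero_le_one) hp.le)
    (fun x hx => Real.rpow_pos_of_pos (lt_max_of_lt_left (lt_min hx one_pos)) _)
    (fun ε M hε => by
      obtain ⟨C, hC, H⟩ := exists_lipschitz_power p (min ε 1) M (lt_min hε one_pos)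
      refine ⟨C, hC, fun x hx y hy => (H _ ⟨min_le_min_right 1 hx.1, (min_le_left _ _).trans hx.2⟩ _
        ⟨min_le_min_right 1 hy.1, (min_le_left _ _).trans hy.2⟩).trans ?_⟩
      have := abs_min_sub_min_le_max x 1 y 1
      rw [sub_self, abs_zero, max_eq_left (abs_nonneg _)] at this
      exact mul_le_mul_of_nonneg_left this hC) hc
  -- The solution decreases from the value `1`, so the truncation at `1` is never felt.
  have hV1 : ∀ t ∈ Icc 0 T₁, V t ≤ 1 := fun t ht =>
    hV ▸ (h.strictAntiOn hf hf0 hc hT₁).antitoneOn ⟨le_rfl, hT₁.le⟩ ht ht.1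
  have h' : IsSolution c (power p) T₁ V W :=
    ⟨h.toIsProfile.congr fun t ht => by simp only [f, min_eq_left (hV1 t ht)], h.pos, h.fst_end,
      h.trace_end⟩
  set l := T₁ / T
  have hl : 0 < l := div_pos hT₁ hT
  -- The amplitude for which `k ^ p = k * l ^ 2`, available since `p ≠ 1`.
  set k := l ^ (2 / (p - 1))
  have hk : 0 < k := Real.rpow_pos_of_pos hl _
  have hkl : k ^ p = k * l ^ 2 := by
    have := sub_ne_zero.2 hp1
    rw [← Real.rpow_mul hl.le, ← Real.rpow_natCast l, ← Real.rpow_add hl]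
    congr 1
    push_cast
    field_simp
    ring
  have h3 := h'.rescale (g := power p) hk hl fun x => by rw [power_mul hk, hkl]
  rw [show T₁ / l = T by simp only [l]; field_simp] at h3
  exact ⟨_, _, h3⟩

end Steklov

namespace Steklov

open MeasureTheory Filter Topology

/-! ### Regularity of profiles -/

/-- Weighted averages of `g` over the segment from `0` to `t`. -/
noncomputable def wmean (ρ g : ℝ → ℝ) (t : ℝ) : ℝ := ∫ s in (0 : ℝ)..1, ρ s * g (t * s)

theorem hasDerivAt_wmean {ρ g : ℝ → ℝ} (hρ : Continuous ρ) (hg : ContDiff ℝ 1 g) (t : ℝ) :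
    HasDerivAt (wmean ρ g) (wmean (fun s => ρ s * s) (deriv g) t) t := by
  have hg0 : Continuous g := hg.continuous
  have hg1 : Continuous (deriv g) := hg.continuous_deriv le_rfl
  have hF : ∀ x : ℝ, Continuous fun s => ρ s * g (x * s) := fun x => by fun_prop
  have hF' : ∀ x : ℝ, Continuous fun s => ρ s * s * deriv g (x * s) := fun x => by fun_prop
  have hc : Continuous fun q : ℝ × ℝ => ρ q.2 * q.2 * deriv g (q.1 * q.2) := by fun_prop
  obtain ⟨C, hC⟩ := ((isCompact_closedBall t 1).prod (isCompact_Icc (a := (0 : ℝ)) (b := 1))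
    ).exists_bound_of_continuousOn hc.continuousOn
  refine (intervalIntegral.hasDerivAt_integral_of_dominated_loc_of_deriv_le (μ := volume)
    (F := fun x s => ρ s * g (x * s)) (F' := fun x s => ρ s * s * deriv g (x * s))
    (s := closedBall t 1) (bound := fun _ => C) (closedBall_mem_nhds t one_pos)
    (.of_forall fun x => (hF x).aestronglyMeasurable) ((hF t).intervalIntegrable _ _)
    (hF' t).aestronglyMeasurable (.of_forall fun s hs x hx => ?_) (by simp)
    (.of_forall fun s hs x hx => ?_)).2
  · rw [uIoc_of_le zero_le_one] at hs
    exact hC (x, s) ⟨hx, hs.1.le, hs.2⟩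
  · have h1 := ((hg.differentiable one_ne_zero) (x * s)).hasDerivAt.comp x
      ((hasDerivAt_id x).mul_const s)
    exact (h1.const_mul (ρ s)).congr_deriv (by simp; ring)

/-- Differentiating under the integral multiplies the weight by `s`; the induction therefore needs
arbitrary continuous weights. -/
theorem contDiff_wmean (n : ℕ) : ∀ {ρ g : ℝ → ℝ}, Continuous ρ → ContDiff ℝ n g →
    ContDiff ℝ n (wmean ρ g) := by
  induction n with
  | zero =>
    intro ρ g hρ hg
    have hg0 := hg.continuous
    exact contDiff_zero.2 <| intervalIntegral.continuous_parametric_intervalIntegral_of_continuous'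
      (f := fun t s => ρ s * g (t * s)) (by fun_prop) 0 1
  | succ n ih =>
    intro ρ g hρ hg
    have hg1 : ContDiff ℝ 1 g := hg.of_le (by exact_mod_cast Nat.le_add_left 1 n)
    push_cast at hg ⊢
    refine contDiff_succ_iff_deriv.2
      ⟨fun t => (hasDerivAt_wmean hρ hg1 t).differentiableAt, by simp, ?_⟩
    rw [show deriv (wmean ρ g) = wmean (fun s => ρ s * s) (deriv g) from
      funext fun t => (hasDerivAt_wmean hρ hg1 t).deriv]
    exact ih (by fun_prop) (contDiff_succ_iff_deriv.1 hg).2.2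

theorem contDiff_mean {n : ℕ} {g : ℝ → ℝ} (hg : ContDiff ℝ n g) : ContDiff ℝ n (mean g) := by
  have := contDiff_wmean n (ρ := fun _ => 1) continuous_const hg
  have he : wmean (fun _ => 1) g = mean g := funext fun t => by simp [wmean, mean]
  rwa [he] at this

/-- A `Cⁿ` function on a compact interval extends to the line. -/
theorem exists_contDiff_extension {a b : ℝ} (hab : a < b) (n : ℕ) : ∀ {g : ℝ → ℝ},
    ContDiffOn ℝ n g (Icc a b) → ∃ G, ContDiff ℝ n G ∧ EqOn G g (Icc a b) := by
  induction n with
  | zero =>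
    intro g hg
    refine ⟨IccExtend hab.le ((Icc a b).domRestrict g), contDiff_zero.2 ?_, fun t ht => ?_⟩
    · exact (continuousOn_iff_continuous_domRestrict.1 hg.continuousOn).Icc_extend'
    · rw [IccExtend_of_mem hab.le _ ht, domRestrict_apply]
  | succ n ih =>
    intro g hg
    push_cast at hg
    obtain ⟨hd, -, hg'⟩ := (contDiffOn_succ_iff_derivWithin (uniqueDiffOn_Icc hab)).1 hg
    obtain ⟨G', hG', heq⟩ := ih hg'
    have hder : ∀ t, HasDerivAt (fun t => g a + ∫ s in a..t, G' s) (G' t) t := fun t =>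
      (intervalIntegral.integral_hasDerivAt_right (hG'.continuous.intervalIntegrable _ _)
        (hG'.continuous.stronglyMeasurableAtFilter _ _) hG'.continuous.continuousAt).const_add _
    refine ⟨fun t => g a + ∫ s in a..t, G' s, ?_, fun t ht => ?_⟩
    · push_cast
      refine contDiff_succ_iff_deriv.2 ⟨fun t => (hder t).differentiableAt, by simp, ?_⟩
      rwa [show deriv (fun t => g a + ∫ s in a..t, G' s) = G' from funext fun t => (hder t).deriv]
    · have := intervalIntegral.integral_eq_sub_of_hasDerivAt_of_le (f := g) (f' := G') ht.1
        (hg.continuousOn.mono (Icc_subset_Icc_right ht.2)) (fun s hs => ?_)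
        (hG'.continuous.intervalIntegrable _ _)
      · simp only [this]
        ring
      · have hs' : s ∈ Icc a b := ⟨hs.1.le, hs.2.le.trans ht.2⟩
        rw [heq hs']
        exact (hd s hs').hasDerivWithinAt.hasDerivAt (Icc_mem_nhds hs.1 (hs.2.trans_le ht.2))

theorem contDiffOn_mean {n : ℕ} {g : ℝ → ℝ} {a : ℝ} (ha : 0 < a)
    (hg : ContDiffOn ℝ n g (Icc 0 a)) : ContDiffOn ℝ n (mean g) (Icc 0 a) := by
  obtain ⟨G, hG, heq⟩ := exists_contDiff_extension ha n hg
  exact (contDiff_mean hG).contDiffOn.congr fun t ht =>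
    mean_congr ht.1 fun s hs => (heq ⟨hs.1, hs.2.trans ht.2⟩).symm

theorem contDiffOn_succ_of_hasDerivWithinAt {n : ℕ} {F F' : ℝ → ℝ} {s : Set ℝ}
    (hs : UniqueDiffOn ℝ s) (h : ∀ x ∈ s, HasDerivWithinAt F (F' x) s x)
    (h' : ContDiffOn ℝ n F' s) : ContDiffOn ℝ (n + 1) F s :=
  (contDiffOn_succ_iff_derivWithin hs).2 ⟨fun x hx => (h x hx).differentiableWithinAt, by simp,
    h'.congr fun x hx => (h x hx).derivWithin (hs x hx)⟩

/-- Away from the origin averaging gains one derivative. -/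
theorem contDiffOn_mean_Ioc {n : ℕ} {g : ℝ → ℝ} {T : ℝ} (hgc : Continuous g)
    (hg : ContDiffOn ℝ n g (Ioc 0 T)) : ContDiffOn ℝ (n + 1) (mean g) (Ioc 0 T) := by
  have h1 : ContDiffOn ℝ (n + 1) (fun t => t * mean g t) (Ioc 0 T) :=
    contDiffOn_succ_of_hasDerivWithinAt (uniqueDiffOn_Ioc 0 T)
      (fun t _ => (hasDerivAt_mul_mean hgc t).hasDerivWithinAt) hg
  refine (h1.div contDiffOn_id fun t ht => ht.1.ne').congr fun t ht => ?_
  exact (mul_div_cancel_left₀ _ ht.1.ne').symm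

theorem contDiffOn_power_comp {p : ℝ} {n : ℕ} {V : ℝ → ℝ} {s : Set ℝ} (hV : ContDiffOn ℝ n V s)
    (hpos : ∀ t ∈ s, 0 < V t) : ContDiffOn ℝ n (fun t => power p (V t)) s :=
  (hV.rpow_const_of_ne fun t ht => (hpos t ht).ne').congr fun t ht =>
    power_of_nonneg (hpos t ht).le

/-- Two regimes overlap: near the origin averaging only preserves smoothness but `V > 0` makes the
power smooth; near `T` the power of `V` may be merely continuous, but averaging gains a derivative.
-/
theorem IsSolution.contDiffOn {p c T : ℝ} {V W : ℝ → ℝ} (hp : 0 < p)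
    (h : IsSolution c (power p) T V W) (hT : 0 < T) : ContDiffOn ℝ 4 V (Icc 0 T) := by
  have hfc := h.continuous_comp (continuous_power hp)
  have hV := fun t ht => h.hasDerivWithinAt_fst (t := t) ht
  have hW := fun t ht => h.hasDerivWithinAt_snd (continuous_power hp) (t := t) ht
  have near_zero : ∀ a ∈ Ioo 0 T, ContDiffOn ℝ 4 V (Icc 0 a) := fun a ha => by
    have hsub : Icc 0 a ⊆ Icc 0 T := Icc_subset_Icc_right ha.2.le
    have hpos : ∀ t ∈ Icc 0 a, 0 < V t := fun t ht => h.pos t ⟨ht.1, ht.2.trans_lt ha.2⟩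
    have hud := uniqueDiffOn_Icc ha.1
    have stepW : ∀ n : ℕ, ContDiffOn ℝ n V (Icc 0 a) → ContDiffOn ℝ (n + 1) W (Icc 0 a) :=
      fun n hn => contDiffOn_succ_of_hasDerivWithinAt hud (fun t ht => (hW t (hsub ht)).mono hsub)
        (contDiffOn_mean ha.1 (contDiffOn_power_comp hn hpos))
    have stepV : ∀ n : ℕ, ContDiffOn ℝ n W (Icc 0 a) → ContDiffOn ℝ (n + 1) V (Icc 0 a) :=
      fun n hn => contDiffOn_succ_of_hasDerivWithinAt hud (fun t ht => (hV t (hsub ht)).mono hsub)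
        (contDiffOn_mean ha.1 hn)
    have h0 : ContDiffOn ℝ (0 : ℕ) V (Icc 0 a) := contDiffOn_zero.2 h.cont_fst.continuousOn
    exact mod_cast stepV 3 (mod_cast stepW 2 (mod_cast stepV 1 (mod_cast stepW 0 h0)))
  have near_end : ContDiffOn ℝ 4 V (Ioc 0 T) := by
    have hsub : Ioc 0 T ⊆ Icc 0 T := Ioc_subset_Icc_self
    have hud := uniqueDiffOn_Ioc 0 T
    -- Four gains from a continuous right side: its mean is `C¹`, `W` is `C²`, `mean W` is `C³`, `V`
    -- is `C⁴`.
    have h0 : ContDiffOn ℝ (0 : ℕ) (fun t => power p (V t)) (Ioc 0 T) :=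
      contDiffOn_zero.2 hfc.continuousOn
    have h1 := contDiffOn_mean_Ioc hfc h0
    have h2 : ContDiffOn ℝ (1 + 1) W (Ioc 0 T) := mod_cast
      contDiffOn_succ_of_hasDerivWithinAt (n := 1) hud (fun t ht => (hW t (hsub ht)).mono hsub)
        (mod_cast h1)
    have h3 := contDiffOn_mean_Ioc (n := 2) h.cont_snd (mod_cast h2)
    exact mod_cast contDiffOn_succ_of_hasDerivWithinAt (n := 3) hud
      (fun t ht => (hV t (hsub ht)).mono hsub) (mod_cast h3)
  intro t ht
  rcases ht.2.eq_or_lt with rfl | htT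
  · refine (near_end t ⟨hT, le_rfl⟩).mono_of_mem_nhdsWithin ?_
    filter_upwards [self_mem_nhdsWithin, nhdsWithin_le_nhds (Ioi_mem_nhds hT)] with s hs hs'
    exact ⟨hs', hs.2⟩
  · obtain ⟨a, hta, haT⟩ := exists_between htT
    refine (near_zero a ⟨ht.1.trans_lt hta, haT⟩ t ⟨ht.1, hta.le⟩).mono_of_mem_nhdsWithin ?_
    filter_upwards [self_mem_nhdsWithin, nhdsWithin_le_nhds (Iio_mem_nhds hta)] with s hs hs'
    exact ⟨hs.1, (mem_Iio.1 hs').le⟩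

end Steklov

namespace Steklov

open MeasureTheory Filter Topology

/-! ### Radial functions on the plane -/

/-- The radial variable `|x|² / 4`, in which the Laplacian is `V ↦ (t V')'`. -/
noncomputable def rad (x : Plane) : ℝ := ‖x‖ ^ 2 / 4

/-- A point of the plane with `rad (ray t) = t`. -/
noncomputable def ray (t : ℝ) : Plane := (2 * √t) • EuclideanSpace.single 0 1

theorem norm_ray (t : ℝ) : ‖ray t‖ = 2 * √t := by
  simp [ray, norm_smul, abs_of_nonneg (Real.sqrt_nonneg t)]

theorem rad_ray {t : ℝ} (ht : 0 ≤ t) : rad (ray t) = t := by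
  rw [rad, norm_ray, mul_pow, Real.sq_sqrt ht]
  ring

theorem norm_ray_rad (x : Plane) : ‖ray (rad x)‖ = ‖x‖ := by
  rw [norm_ray, rad, Real.sqrt_div (sq_nonneg _), Real.sqrt_sq (norm_nonneg _),
    show (4 : ℝ) = 2 ^ 2 by norm_num, Real.sqrt_sq zero_le_two]
  ring

theorem rad_nonneg (x : Plane) : 0 ≤ rad x := by unfold rad; positivity

theorem rad_pos {x : Plane} (hx : x ≠ 0) : 0 < rad x := by
  have := norm_pos_iff.2 hx
  unfold rad
  positivity

theorem contDiff_rad {n : WithTop ℕ∞} : ContDiff ℝ n rad := (contDiff_norm_sq ℝ).div_const 4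

theorem continuous_rad : Continuous rad := contDiff_rad (n := 0).continuous

theorem continuous_ray : Continuous ray := by unfold ray; fun_prop

theorem rad_lt {R : ℝ} {x : Plane} (hx : x ∈ ball 0 R) : rad x < R ^ 2 / 4 := by
  rw [mem_ball_zero_iff] at hx
  unfold rad
  gcongr

theorem rad_le {R : ℝ} {x : Plane} (hx : x ∈ closedBall 0 R) : rad x ≤ R ^ 2 / 4 := by
  rw [mem_closedBall_zero_iff] at hx
  unfold rad
  gcongr

theorem ray_mem_ball {R t : ℝ} (hR : 0 < R) (ht : t ∈ Ico 0 (R ^ 2 / 4)) : ray t ∈ ball 0 R := by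
  rw [mem_ball_zero_iff, norm_ray]
  have := (Real.sqrt_lt' (by positivity : 0 < R / 2)).2 (by linarith [ht.2] : t < (R / 2) ^ 2)
  linarith

theorem ray_mem_closedBall {R t : ℝ} (hR : 0 < R) (ht : t ∈ Icc 0 (R ^ 2 / 4)) :
    ray t ∈ closedBall 0 R := by
  rw [mem_closedBall_zero_iff, norm_ray]
  have := (Real.sqrt_le_left (by positivity : 0 ≤ R / 2)).2 (by linarith [ht.2] : t ≤ (R / 2) ^ 2)
  linarith

theorem hasFDerivAt_rad (x : Plane) : HasFDerivAt rad ((1 / 2 : ℝ) • innerSL ℝ x) x := by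
  have h := ((hasStrictFDerivAt_norm_sq x).hasFDerivAt).const_mul (1 / 4 : ℝ)
  refine (h.congr_of_eventuallyEq (.of_forall fun y => ?_)).congr_fderiv ?_
  · simp only [rad]
    ring
  · ext y
    simp
    ring

theorem hasFDerivAt_comp_rad {V : ℝ → ℝ} {V' : ℝ} {x : Plane} (h : HasDerivAt V V' (rad x)) :
    HasFDerivAt (fun y => V (rad y)) ((V' / 2) • innerSL ℝ x) x := by
  refine (h.comp_hasFDerivAt x (hasFDerivAt_rad x)).congr_fderiv ?_
  rw [smul_smul]
  congr 1
  ring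

theorem laplacian_eq_sum_fderiv (u : Plane → ℝ) (x : Plane) :
    Laplacian.laplacian u x = ∑ i : Fin 2, fderiv ℝ (fderiv ℝ u) x
      (EuclideanSpace.basisFun (Fin 2) ℝ i) (EuclideanSpace.basisFun (Fin 2) ℝ i) := by
  rw [laplacian_eq_iteratedFDeriv_orthonormalBasis u (EuclideanSpace.basisFun (Fin 2) ℝ)]
  simp only [iteratedFDeriv_two_apply]
  rfl

/-- The Laplacian of a radial function. -/
theorem laplacian_comp_rad {V V₁ V₂ : ℝ → ℝ} {I : Set ℝ} (hI : IsOpen I)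
    (h₁ : ∀ t ∈ I, HasDerivAt V (V₁ t) t) (h₂ : ∀ t ∈ I, HasDerivAt V₁ (V₂ t) t) {x : Plane}
    (hx : rad x ∈ I) :
    Laplacian.laplacian (fun y => V (rad y)) x = rad x * V₂ (rad x) + V₁ (rad x) := by
  have hev : fderiv ℝ (fun y => V (rad y)) =ᶠ[𝓝 x]
      fun y => (V₁ (rad y) / 2) • innerSL ℝ y := by
    filter_upwards [(hI.preimage continuous_rad).mem_nhds hx] with y hy
    exact (hasFDerivAt_comp_rad (h₁ _ hy)).fderiv
  let B : Plane →L[ℝ] Plane →L[ℝ] ℝ := innerSL ℝ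
  have hB : ∀ y z, B y z = inner ℝ y z := fun _ _ => rfl
  have hd : HasFDerivAt (fun y => (V₁ (rad y) / 2) • innerSL ℝ y)
      ((V₁ (rad x) / 2) • B +
        ((1 / 2 : ℝ) • (V₂ (rad x) / 2) • innerSL ℝ x).smulRight (innerSL ℝ x)) x := by
    have h := (hasFDerivAt_comp_rad (h₂ _ hx)).const_mul (1 / 2 : ℝ)
    have h3 := h.smul (B.hasFDerivAt (x := x))
    refine (h3.congr_of_eventuallyEq (.of_forall fun y => ?_)).congr_fderiv ?_
    · simp only [Pi.smul_apply', div_eq_inv_mul, mul_one]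
      rfl
    · congr 2
      ring
  rw [laplacian_eq_sum_fderiv, (hd.congr_of_eventuallyEq hev).fderiv]
  have hn : ‖x‖ ^ 2 = x 0 ^ 2 + x 1 ^ 2 := by simp [EuclideanSpace.real_norm_sq_eq]
  simp only [rad, hn, Fin.sum_univ_two]
  simp [hB, EuclideanSpace.inner_single_right]
  ring

theorem hasDerivAt_mean {W : ℝ → ℝ} (hW : Continuous W) {t : ℝ} (ht : 0 < t) :
    HasDerivAt (mean W) ((W t - mean W t) / t) t := by
  have h := (hasDerivAt_mul_mean hW t).div (hasDerivAt_id t) ht.ne'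
  refine (h.congr_of_eventuallyEq ?_).congr_deriv ?_
  · filter_upwards [Ioi_mem_nhds ht] with s hs
    exact (mul_div_cancel_left₀ _ (ne_of_gt hs)).symm
  · simp only [id]
    field_simp

/-- Here `t V'' = W - mean W` and `V' = mean W`. The formula needs `t > 0`; the origin and the
boundary circle are recovered by continuity through `eqOn_closedBall`. -/
theorem laplacian_comp_rad_of_mean {V W : ℝ → ℝ} (hW : Continuous W) {T : ℝ}
    (h : ∀ t ∈ Ioo 0 T, HasDerivAt V (mean W t) t) {x : Plane} (hx : rad x ∈ Ioo 0 T) :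
    Laplacian.laplacian (fun y => V (rad y)) x = W (rad x) := by
  rw [laplacian_comp_rad isOpen_Ioo h (fun t ht => hasDerivAt_mean hW ht.1) hx,
    mul_div_cancel₀ _ hx.1.ne']
  ring

theorem contDiffOn_laplacian {n : WithTop ℕ∞} {u : Plane → ℝ} {s : Set Plane} (hs : IsOpen s)
    (hu : ContDiffOn ℝ (n + 2) u s) : ContDiffOn ℝ n (Laplacian.laplacian u) s := by
  have h1 : ContDiffOn ℝ (n + 1) (fderiv ℝ u) s :=
    hu.fderiv_of_isOpen hs (by rw [add_assoc, one_add_one_eq_two])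
  have h2 : ContDiffOn ℝ n (fderiv ℝ (fderiv ℝ u)) s := h1.fderiv_of_isOpen hs le_rfl
  refine (ContDiffOn.sum (s := Finset.univ) fun i _ =>
    (h2.clm_apply contDiffOn_const).clm_apply contDiffOn_const).congr fun x _ =>
      laplacian_eq_sum_fderiv u x

theorem uniqueDiffOn_closedBall {R : ℝ} (hR : 0 < R) :
    UniqueDiffOn ℝ (closedBall (0 : Plane) R) :=
  uniqueDiffOn_convex (convex_closedBall 0 R)
    ((nonempty_ball.2 hR).mono ball_subset_interior_closedBall)

theorem continuousOn_laplacianWithin {u : Plane → ℝ} {s : Set Plane} (hs : UniqueDiffOn ℝ s)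
    (hu : ContDiffOn ℝ 2 u s) : ContinuousOn (laplacianWithin u s) s := by
  have h := hu.continuousOn_iteratedFDerivWithin (m := 2) le_rfl hs
  refine (continuousOn_finsetSum Finset.univ fun i _ =>
    (ContinuousMultilinearMap.apply ℝ (fun _ : Fin 2 => Plane) ℝ
      ![EuclideanSpace.basisFun (Fin 2) ℝ i, EuclideanSpace.basisFun (Fin 2) ℝ i]
      ).continuous.comp_continuousOn h).congr fun x hx => ?_
  rw [laplacianWithin_eq_iteratedFDerivWithin_orthonormalBasis u hs hx
    (EuclideanSpace.basisFun (Fin 2) ℝ)]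
  rfl

theorem laplacianWithin_eq_laplacian {u : Plane → ℝ} {s : Set Plane} (hs : UniqueDiffOn ℝ s)
    {x : Plane} (hx : s ∈ 𝓝 x) : laplacianWithin u s x = Laplacian.laplacian u x := by
  rw [laplacianWithin_eq_iteratedFDerivWithin_orthonormalBasis u hs (mem_of_mem_nhds hx)
    (EuclideanSpace.basisFun (Fin 2) ℝ), laplacian_eq_iteratedFDeriv_orthonormalBasis u
    (EuclideanSpace.basisFun (Fin 2) ℝ)]
  have : iteratedFDerivWithin ℝ 2 u s x = iteratedFDeriv ℝ 2 u x := by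
    rw [← iteratedFDerivWithin_univ]
    exact iteratedFDerivWithin_congr_set (eventuallyEq_univ.2 hx) 2
  simp only [this]

/-- Continuous functions on the closed disc that agree on the punctured open disc agree. -/
theorem eqOn_closedBall {R : ℝ} (hR : 0 < R) {φ ψ : Plane → ℝ}
    (hφ : ContinuousOn φ (closedBall 0 R))
    (hψ : ContinuousOn ψ (closedBall 0 R)) (h : ∀ x ∈ ball 0 R, x ≠ 0 → φ x = ψ x) :
    EqOn φ ψ (closedBall 0 R) := by
  refine EqOn.of_subset_closure (s := ball 0 R ∩ {0}ᶜ) (fun x hx => h x hx.1 hx.2) hφ hψ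
    (inter_subset_left.trans ball_subset_closedBall) ?_
  rw [← closure_ball 0 hR.ne']
  exact closure_minimal ((dense_compl_singleton 0).open_subset_closure_inter isOpen_ball)
    isClosed_closure

/-- First and second order boundary behaviour of radial functions. -/
theorem radial_closedBall {R : ℝ} (hR : 0 < R) {u : Plane → ℝ} {V W : ℝ → ℝ}
    (hu : ContDiffOn ℝ 2 u (closedBall 0 R)) (huV : ∀ x ∈ ball 0 R, u x = V (rad x))
    (hW : Continuous W) (h : ∀ t ∈ Ioo 0 (R ^ 2 / 4), HasDerivAt V (mean W t) t) :
    (∀ x ∈ closedBall 0 R, laplacianWithin u (closedBall 0 R) x = W (rad x)) ∧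
      ∀ x ∈ closedBall 0 R,
        fderivWithin ℝ u (closedBall 0 R) x x = 2 * rad x * mean W (rad x) := by
  have hud := uniqueDiffOn_closedBall hR
  have hnhds : ∀ x ∈ ball (0 : Plane) R, closedBall 0 R ∈ 𝓝 x := fun x hx =>
    mem_of_superset (isOpen_ball.mem_nhds hx) ball_subset_closedBall
  have hev : ∀ x ∈ ball 0 R, u =ᶠ[𝓝 x] fun y => V (rad y) := fun x hx => by
    filter_upwards [isOpen_ball.mem_nhds hx] with y hy using huV y hy
  constructor
  · refine eqOn_closedBall hR (continuousOn_laplacianWithin hud hu)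
      (hW.comp continuous_rad).continuousOn fun x hx hx0 => ?_
    rw [laplacianWithin_eq_laplacian hud (hnhds x hx),
      (laplacian_congr_nhds (hev x hx)).eq_of_nhds]
    exact laplacian_comp_rad_of_mean hW h ⟨rad_pos hx0, rad_lt hx⟩
  · refine eqOn_closedBall hR
      ((hu.continuousOn_fderivWithin hud (by norm_num)).clm_apply continuousOn_id)
      (Continuous.continuousOn ?_) fun x hx hx0 => ?_
    · exact (continuous_const.mul continuous_rad).mul ((continuous_mean hW).comp continuous_rad)
    · rw [fderivWithin_of_mem_nhds (hnhds x hx), (hev x hx).fderiv_eq,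
        (hasFDerivAt_comp_rad (h _ ⟨rad_pos hx0, rad_lt hx⟩)).fderiv]
      simp [rad]
      ring

/-- A radial `C²` function with Laplacian `W` satisfies the integrated radial equation. -/
theorem radial_profile {R : ℝ} (hR : 0 < R) {v : Plane → ℝ} {V W : ℝ → ℝ}
    (hv : ContDiffOn ℝ 2 v (ball 0 R)) (hvV : ∀ x ∈ ball 0 R, v x = V (rad x))
    (hV : Continuous V) (hW : Continuous W)
    (hvW : ∀ t ∈ Ico 0 (R ^ 2 / 4), Laplacian.laplacian v (ray t) = W t) :
    (∀ t ∈ Ioo 0 (R ^ 2 / 4), HasDerivAt V (mean W t) t) ∧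
      ∀ t ∈ Icc 0 (R ^ 2 / 4), V t = V 0 + pot W t := by
  set T := R ^ 2 / 4
  have hT : 0 < T := by positivity
  have hVray : ∀ t ∈ Ico 0 T, V t = v (ray t) := fun t ht => by
    rw [hvV _ (ray_mem_ball hR ht), rad_ray ht.1]
  set e : Plane := EuclideanSpace.single 0 1
  have hray : ∀ t, 0 < t → HasDerivAt ray ((1 / √t) • e) t := fun t ht => by
    have := (((Real.hasDerivAt_sqrt ht.ne').const_mul 2).smul_const e)
    refine this.congr_deriv ?_
    congr 1
    field_simp
  have hdv : ∀ x ∈ ball 0 R, DifferentiableAt ℝ v x := fun x hx =>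
    (hv.differentiableOn two_ne_zero).differentiableAt (isOpen_ball.mem_nhds hx)
  have hV1 : ∀ t ∈ Ioo 0 T, HasDerivAt V (fderiv ℝ v (ray t) ((1 / √t) • e)) t := fun t ht => by
    have h := (hdv _ (ray_mem_ball hR ⟨ht.1.le, ht.2⟩)).hasFDerivAt.comp_hasDerivAt t (hray t ht.1)
    refine h.congr_of_eventuallyEq ?_
    filter_upwards [Ioo_mem_nhds ht.1 ht.2] with s hs using hVray s ⟨hs.1.le, hs.2⟩
  have hC2 : ContDiffOn ℝ 2 V (Ioo 0 T) := by
    have hrc : ContDiffOn ℝ 2 ray (Ioo 0 T) :=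
      (contDiffOn_const.mul (contDiffOn_id.sqrt fun t ht => ht.1.ne')).smul contDiffOn_const
    exact (hv.comp hrc fun t ht => ray_mem_ball hR ⟨ht.1.le, ht.2⟩).congr
      fun t ht => hVray t ⟨ht.1.le, ht.2⟩
  have hD1 : ∀ t ∈ Ioo 0 T, HasDerivAt V (deriv V t) t := fun t ht =>
    (hV1 t ht).differentiableAt.hasDerivAt
  have hD2 : ∀ t ∈ Ioo 0 T, HasDerivAt (deriv V) (deriv (deriv V) t) t := fun t ht =>
    (((hC2.deriv_of_isOpen (m := 1) isOpen_Ioo (by norm_num)).differentiableOn one_ne_zero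
      ).differentiableAt (isOpen_Ioo.mem_nhds ht)).hasDerivAt
  have hWeq : ∀ t ∈ Ioo 0 T, t * deriv (deriv V) t + deriv V t = W t := fun t ht => by
    have hb := ray_mem_ball hR (Ioo_subset_Ico_self ht)
    have hev : v =ᶠ[𝓝 (ray t)] fun y => V (rad y) := by
      filter_upwards [isOpen_ball.mem_nhds hb] with y hy using hvV y hy
    have hrt := rad_ray ht.1.le
    rw [← hvW t ⟨ht.1.le, ht.2⟩, (laplacian_congr_nhds hev).eq_of_nhds,
      laplacian_comp_rad isOpen_Ioo hD1 hD2 (by rwa [hrt]), hrt]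
  -- This is `t V'` for `t > 0`, written so that it is visibly continuous and zero at `t = 0`, where
  -- `ray` is not differentiable. Integrating `G' = W` from `0` thus leaves no singular term.
  set G : ℝ → ℝ := fun t => √t * fderiv ℝ v (ray t) e
  have hGc : ContinuousOn G (Ico 0 T) :=
    Real.continuous_sqrt.continuousOn.mul <| ((hv.continuousOn_fderiv_of_isOpen isOpen_ball
      (by norm_num)).comp continuous_ray.continuousOn fun t ht => ray_mem_ball hR ht).clm_apply
        continuousOn_const
  have hGV : ∀ t ∈ Ioo 0 T, G t = t * deriv V t := fun t ht => by
    rw [(hV1 t ht).deriv, map_smul, smul_eq_mul, ← mul_assoc, mul_one_div]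
    simp only [G, Real.div_sqrt]
  have hGd : ∀ t ∈ Ioo 0 T, HasDerivAt G (W t) t := fun t ht => by
    refine (((hasDerivAt_id t).mul (hD2 t ht)).congr_of_eventuallyEq ?_).congr_deriv ?_
    · filter_upwards [Ioo_mem_nhds ht.1 ht.2] with s hs using hGV s hs
    · rw [← hWeq t ht]
      simp only [id]
      ring
  have hmean : ∀ t ∈ Ioo 0 T, HasDerivAt V (mean W t) t := fun t ht => by
    have h1 := intervalIntegral.integral_eq_sub_of_hasDerivAt_of_le ht.1.le
      (hGc.mono fun s hs => ⟨hs.1, hs.2.trans_lt ht.2⟩)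
      (fun s hs => hGd s ⟨hs.1, hs.2.trans ht.2⟩) (hW.intervalIntegrable _ _)
    rw [← mul_mean, hGV t ht] at h1
    have h2 : mean W t = deriv V t := by
      refine mul_left_cancel₀ ht.1.ne' (h1.trans ?_)
      simp [G]
    rw [h2]
    exact hD1 t ht
  refine ⟨hmean, fun t ht => ?_⟩
  have := intervalIntegral.integral_eq_sub_of_hasDerivAt_of_le ht.1 hV.continuousOn
    (fun s hs => hmean s ⟨hs.1, hs.2.trans_le ht.2⟩) ((continuous_mean hW).intervalIntegrable _ _)
  rw [pot, this]
  ring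

end Steklov

namespace Steklov

open Filter Topology

/-! ### Profiles and solutions of the Steklov problem -/

variable {R p σ : ℝ}

theorem outwardNormalDeriv_eq {u : Plane → ℝ} {x : Plane} :
    outwardNormalDeriv R u x = R⁻¹ * fderivWithin ℝ u (closedBall 0 R) x x := by
  simp [outwardNormalDeriv]

theorem rad_of_mem_sphere {x : Plane} (hx : x ∈ sphere (0 : Plane) R) : rad x = R ^ 2 / 4 := by
  rw [rad, mem_sphere_zero_iff_norm.1 hx]

theorem mapsTo_rad : MapsTo rad (closedBall (0 : Plane) R) (Icc 0 (R ^ 2 / 4)) :=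
  fun x hx => ⟨rad_nonneg x, rad_le hx⟩

theorem IsSolution.contDiffOn_comp_rad {c : ℝ} {V W : ℝ → ℝ} (hR : 0 < R) (hp : 0 < p)
    (h : IsSolution c (power p) (R ^ 2 / 4) V W) :
    ContDiffOn ℝ 4 (fun x => V (rad x)) (closedBall 0 R) :=
  (h.contDiffOn hp (by positivity)).comp contDiff_rad.contDiffOn mapsTo_rad

/-- The Steklov boundary operator on radial functions is the trace. -/
theorem steklov_eq_trace {u : Plane → ℝ} {W : ℝ → ℝ} (hR : 0 < R) {x : Plane}
    (hx : x ∈ sphere (0 : Plane) R)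
    (h : (∀ x ∈ closedBall 0 R, laplacianWithin u (closedBall 0 R) x = W (rad x)) ∧
      ∀ x ∈ closedBall 0 R,
        fderivWithin ℝ u (closedBall 0 R) x x = 2 * rad x * mean W (rad x)) :
    laplacianWithin u (closedBall 0 R) x - (1 - σ) * (1 / R) * outwardNormalDeriv R u x =
      trace ((1 - σ) / 2) W (R ^ 2 / 4) := by
  have hx' := sphere_subset_closedBall hx
  rw [outwardNormalDeriv_eq, h.1 x hx', h.2 x hx', rad_of_mem_sphere hx, trace]
  field_simp
  ring

/-- A solution of the profile problem gives a positive radial solution. -/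
theorem IsSolution.isPositiveRadialSteklovSolution {V W : ℝ → ℝ} (hR : 0 < R) (hp : 0 < p)
    (h : IsSolution ((1 - σ) / 2) (power p) (R ^ 2 / 4) V W) :
    IsPositiveRadialSteklovSolution p σ R fun x => V (rad x) := by
  have hT : 0 < R ^ 2 / 4 := by positivity
  set u : Plane → ℝ := fun x => V (rad x)
  have hu := h.contDiffOn_comp_rad hR hp
  have hpos : ∀ x ∈ ball (0 : Plane) R, 0 < u x := fun x hx =>
    h.pos _ ⟨rad_nonneg x, rad_lt hx⟩
  have hfc := h.continuous_comp (continuous_power hp)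
  have hV : ∀ t ∈ Ioo 0 (R ^ 2 / 4), HasDerivAt V (mean W t) t := fun t ht =>
    (h.hasDerivWithinAt_fst (Ioo_subset_Icc_self ht)).hasDerivAt (Icc_mem_nhds ht.1 ht.2)
  have hW : ∀ t ∈ Ioo 0 (R ^ 2 / 4), HasDerivAt W (mean (fun s => power p (V s)) t) t :=
    fun t ht => (h.hasDerivWithinAt_snd (continuous_power hp) (Ioo_subset_Icc_self ht)).hasDerivAt
      (Icc_mem_nhds ht.1 ht.2)
  have hbd := radial_closedBall hR (hu.of_le (by norm_num)) (fun _ _ => rfl) h.cont_snd hV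
  have hlap : ∀ x ∈ ball (0 : Plane) R, Laplacian.laplacian u x = W (rad x) := fun x hx => by
    rw [← hbd.1 x (ball_subset_closedBall hx)]
    exact (laplacianWithin_eq_laplacian (uniqueDiffOn_closedBall hR)
      (mem_of_superset (isOpen_ball.mem_nhds hx) ball_subset_closedBall)).symm
  have hub := hu.mono ball_subset_closedBall
  refine ⟨⟨hub, hu.of_le (by norm_num), fun x hx => ?_, fun x hx => ?_, fun x hx => ?_⟩,
    fun x _ y _ hxy => by simp only [u, rad, hxy], hpos⟩
  · have hxR : ‖x‖ < R := mem_ball_zero_iff.1 hx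
    -- The Laplacian of `u` is known to be `C²` only in the open disc, so the radial formula is
    -- applied to it on a smaller closed disc containing `x`.
    obtain ⟨r, hxr, hrR⟩ := exists_between hxR
    have hr : 0 < r := (norm_nonneg x).trans_lt hxr
    have hsub : closedBall (0 : Plane) r ⊆ ball 0 R := closedBall_subset_ball hrR
    have hlapC : ContDiffOn ℝ 2 (Laplacian.laplacian u) (ball 0 R) :=
      contDiffOn_laplacian isOpen_ball (hub.of_le (by norm_num))
    have hmono : r ^ 2 / 4 ≤ R ^ 2 / 4 := by gcongr
    have key := (radial_closedBall hr (hlapC.mono hsub)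
      (fun y hy => hlap y (hsub (ball_subset_closedBall hy))) hfc
      fun t ht => hW t ⟨ht.1, ht.2.trans_le hmono⟩).1 x (mem_closedBall_zero_iff.2 hxr.le)
    rw [laplacianWithin_eq_laplacian (uniqueDiffOn_closedBall hr)
      (mem_of_superset (isOpen_ball.mem_nhds (mem_ball_zero_iff.2 hxr)) ball_subset_closedBall)]
      at key
    have hx0 := hpos x hx
    rw [key, power_of_nonneg hx0.le, abs_of_pos hx0, ← Real.rpow_add_one hx0.ne', sub_add_cancel]
  · simp only [u, rad_of_mem_sphere hx, h.fst_end]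
  · rw [steklov_eq_trace hR hx hbd, h.trace_end]

/-- A positive radial solution has a profile solving the profile problem. -/
theorem IsPositiveRadialSteklovSolution.exists_isSolution {v : Plane → ℝ} (hR : 0 < R)
    (hp : 0 < p) (hv : IsPositiveRadialSteklovSolution p σ R v) :
    ∃ V W, IsSolution ((1 - σ) / 2) (power p) (R ^ 2 / 4) V W ∧
      ∀ x ∈ closedBall 0 R, v x = V (rad x) := by
  set T := R ^ 2 / 4
  have hT : 0 < T := by positivity
  have hud := uniqueDiffOn_closedBall hR
  have hmaps : MapsTo ray (Icc 0 T) (closedBall 0 R) := fun t ht => ray_mem_closedBall hR ht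
  have extend : ∀ φ : Plane → ℝ, ContinuousOn φ (closedBall 0 R) →
      ∃ g : ℝ → ℝ, Continuous g ∧ ∀ t ∈ Icc 0 T, g t = φ (ray t) := fun φ hφ =>
    ⟨IccExtend hT.le ((Icc 0 T).domRestrict (φ ∘ ray)),
      (continuousOn_iff_continuous_domRestrict.1
        (hφ.comp continuous_ray.continuousOn hmaps)).Icc_extend',
      fun t ht => by rw [IccExtend_of_mem hT.le _ ht, domRestrict_apply]; rfl⟩
  obtain ⟨V, hVc, hV⟩ := extend v hv.solution.contDiffOn_closedBall.continuousOn
  -- The Laplacian within the closed disc is continuous up to the boundary, so `W` is defined on all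
  -- of `[0, T]`; its radiality follows from that of `v` through `radial_closedBall`.
  obtain ⟨W, hWc, hW⟩ := extend _
    (continuousOn_laplacianWithin hud hv.solution.contDiffOn_closedBall)
  have hvV : ∀ x ∈ closedBall 0 R, v x = V (rad x) := fun x hx => by
    rw [hV _ (mapsTo_rad hx)]
    exact hv.radial x hx _ (hmaps (mapsTo_rad hx)) (norm_ray_rad x).symm
  have hvV' : ∀ x ∈ ball 0 R, v x = V (rad x) := fun x hx => hvV x (ball_subset_closedBall hx)
  have hlapW : ∀ x ∈ ball (0 : Plane) R,
      laplacianWithin v (closedBall 0 R) x = Laplacian.laplacian v x := fun x hx =>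
    laplacianWithin_eq_laplacian hud
      (mem_of_superset (isOpen_ball.mem_nhds hx) ball_subset_closedBall)
  obtain ⟨hder, hVeq⟩ := radial_profile hR
    (hv.solution.contDiffOn_closedBall.mono ball_subset_closedBall) hvV' hVc hWc fun t ht => by
      rw [hW t ⟨ht.1, ht.2.le⟩, hlapW _ (ray_mem_ball hR ht)]
  have hbd := radial_closedBall hR hv.solution.contDiffOn_closedBall hvV' hWc hder
  have hpos : ∀ t ∈ Ico 0 T, 0 < V t := fun t ht => by
    rw [hV t ⟨ht.1, ht.2.le⟩]
    exact hv.pos _ (ray_mem_ball hR ht)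
  have hfc : Continuous fun t => power p (V t) := (continuous_power hp).comp hVc
  obtain ⟨-, hWeq⟩ := radial_profile (v := Laplacian.laplacian v) hR
    (contDiffOn_laplacian isOpen_ball (hv.solution.contDiffOn_ball.of_le (by norm_num)))
    (fun x hx => by rw [← hlapW x hx, hbd.1 x (ball_subset_closedBall hx)]) hWc hfc fun t ht => by
      have hx := ray_mem_ball hR ht
      have hx0 := hpos t ht
      rw [hv.solution.equation _ hx, hvV' _ hx, rad_ray ht.1, power_of_nonneg hx0.le,
        abs_of_pos hx0, ← Real.rpow_add_one hx0.ne', sub_add_cancel]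
  have hend : ray T ∈ sphere (0 : Plane) R := by
    rw [mem_sphere_zero_iff_norm, norm_ray, Real.sqrt_div (sq_nonneg _), Real.sqrt_sq hR.le,
      show (4 : ℝ) = 2 ^ 2 by norm_num, Real.sqrt_sq zero_le_two]
    ring
  refine ⟨V, W, ⟨⟨hVc, hWc, hVeq, hWeq⟩, hpos, ?_, ?_⟩, hvV⟩
  · rw [hV T ⟨hT.le, le_rfl⟩, hv.solution.boundary_zero _ hend]
  · rw [← steklov_eq_trace (σ := σ) hR hend hbd, hv.solution.boundary_steklov _ hend]

end Steklov

theorem theorem1p3 (R p σ : ℝ) (hR : 0 < R) (hp : p ∈ Ioo (0 : ℝ) 1 ∪ Ioi 1) (hσ : -1 < σ) :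
    ∃ u : Plane → ℝ,
      IsPositiveRadialSteklovSolution p σ R u ∧
      ContDiffOn ℝ 4 u (closedBall 0 R) ∧
      IsStrictlyRadiallyDecreasing R u ∧
      ∀ v : Plane → ℝ, IsPositiveRadialSteklovSolution p σ R v →
        EqOn v u (closedBall 0 R) := by
  have hp0 : 0 < p := hp.elim (fun h => h.1) fun h => one_pos.trans h
  have hp1 : p ≠ 1 := hp.elim (fun h => h.2.ne) fun h => ne_of_gt h
  have hc : (1 - σ) / 2 < 1 := by linarith
  have hT : 0 < R ^ 2 / 4 := by positivity
  obtain ⟨V, W, h⟩ := Steklov.exists_isSolution hp0 hp1 hc hT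
  refine ⟨fun x => V (Steklov.rad x), h.isPositiveRadialSteklovSolution hR hp0,
    h.contDiffOn_comp_rad hR hp0, fun x hx y hy hxy => ?_, fun v hv x hx => ?_⟩
  · refine h.strictAntiOn (Steklov.continuous_power hp0) (Steklov.power_nonneg p) hc hT
      (Steklov.mapsTo_rad hx) (Steklov.mapsTo_rad hy) ?_
    unfold Steklov.rad
    gcongr
  · obtain ⟨V', W', h', hv'⟩ :=
      Steklov.IsPositiveRadialSteklovSolution.exists_isSolution hR hp0 hv
    rw [hv' x hx]
    exact h'.eqOn hp0 hp1 h hc hT (Steklov.mapsTo_rad hx)
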